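/- All graphs are finite, simple and undirected, and $L(G)$ denotes the line graph of $G$. For a graph $G$ and a set $S\subseteq V(G)$ with $|S|\ge 2$, a path connecting $S$ is a subgraph $P$ of $G$ that is a path with $S\subseteq V(P)$. Let $\omega_G(S)$ be the maximum number of pairwise edge-disjoint paths connecting $S$ in $G$, and let $\pi_G(S)$ be the maximum number of pairwise internally disjoint paths connecting $S$ in $G$, where two paths $P,P'$ connecting $S$ are internally disjoint if $E(P)\cap E(P')=\varnothing$ and $V(P)\cap V(P')=S$. For $2\le k\le |V(G)|$ put $$\omega_k(G)=\min\{\omega_G(S) : S\subseteq V(G),\ |S|=k\},\qquad \pi_k(G)=\min\{\pi_G(S) : S\subseteq V(G),\ |S|=k\}.$$ **Proposition.** Let $G$ be a $2$-edge-connected graph of order $n$, and let $k$ be an integer with $2\le k\le n$. Then 1. $2^{2-k}\,\omega_k(G)\le \pi_k(L(G))$; 2. $\omega_k(L(G))\ge 2^{2-k}\,\omega_k(G)$; 3. $\pi_k(L(L(G)))\ge 2^{3-k}\,(\pi_k(G)-1)$. -/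

import Mathlib

namespace SimpleGraph

variable {V : Type*} (G : SimpleGraph V)

/-- A path connecting `S`: a subgraph of `G` that is a path and whose vertex set contains `S`. -/
def IsPathConnecting (S : Set V) (P : G.Subgraph) : Prop :=
  (∃ (u v : V) (p : G.Walk u v), p.IsPath ∧ p.toSubgraph = P) ∧ S ⊆ P.verts

/-- `F` is a family of pairwise internally disjoint paths connecting `S`: two different members
have no common edge, and their common vertices are exactly the elements of `S`. -/
def IsInternallyDisjointFamily (S : Set V) (F : Finset G.Subgraph) : Prop :=
  (∀ P ∈ F, G.IsPathConnecting S P) ∧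
    ∀ P ∈ F, ∀ Q ∈ F, P ≠ Q → P.edgeSet ∩ Q.edgeSet = ∅ ∧ P.verts ∩ Q.verts = S

/-- `F` is a family of pairwise edge-disjoint paths connecting `S`. -/
def IsEdgeDisjointFamily (S : Set V) (F : Finset G.Subgraph) : Prop :=
  (∀ P ∈ F, G.IsPathConnecting S P) ∧
    ∀ P ∈ F, ∀ Q ∈ F, P ≠ Q → P.edgeSet ∩ Q.edgeSet = ∅

/-- The local path connectivity `π_G(S)`: the maximum number of pairwise internally disjoint
paths connecting `S` (a maximum for finite `V`, see `le_localPathConn`). -/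
noncomputable def localPathConn (S : Set V) : ℕ :=
  sSup {m : ℕ | ∃ F : Finset G.Subgraph, G.IsInternallyDisjointFamily S F ∧ F.card = m}

/-- The path local edge-connectivity `ω_G(S)`: the maximum number of pairwise edge-disjoint
paths connecting `S` (a maximum for finite `V`, see `le_localPathEdgeConn`). -/
noncomputable def localPathEdgeConn (S : Set V) : ℕ :=
  sSup {m : ℕ | ∃ F : Finset G.Subgraph, G.IsEdgeDisjointFamily S F ∧ F.card = m}

/-- The path `k`-connectivity `π_k(G)`: the minimum of `π_G(S)` over all `k`-subsets `S` of `V`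
(used for `2 ≤ k ≤ |V|` only, so that there is such a set `S`). -/
noncomputable def pathConn (k : ℕ) : ℕ :=
  sInf {m : ℕ | ∃ S : Finset V, S.card = k ∧ G.localPathConn (S : Set V) = m}

/-- The path `k`-edge-connectivity `ω_k(G)`: the minimum of `ω_G(S)` over all `k`-subsets `S`
of `V` (used for `2 ≤ k ≤ |V|` only, so that there is such a set `S`). -/
noncomputable def pathEdgeConn (k : ℕ) : ℕ :=
  sInf {m : ℕ | ∃ S : Finset V, S.card = k ∧ G.localPathEdgeConn (S : Set V) = m}

/-- On a finite graph the numbers of members of families of subgraphs are bounded. -/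
theorem bddAbove_card_family [Finite V] (p : Finset G.Subgraph → Prop) :
    BddAbove {m : ℕ | ∃ F : Finset G.Subgraph, p F ∧ F.card = m} := by
  refine ⟨Nat.card G.Subgraph, ?_⟩
  rintro m ⟨F, -, rfl⟩
  have := Fintype.ofFinite G.Subgraph
  rw [Nat.card_eq_fintype_card]
  exact Finset.card_le_univ F

theorem le_localPathConn [Finite V] {S : Set V} {F : Finset G.Subgraph}
    (hF : G.IsInternallyDisjointFamily S F) : F.card ≤ G.localPathConn S :=
  le_csSup (G.bddAbove_card_family _) ⟨F, hF, rfl⟩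

theorem le_localPathEdgeConn [Finite V] {S : Set V} {F : Finset G.Subgraph}
    (hF : G.IsEdgeDisjointFamily S F) : F.card ≤ G.localPathEdgeConn S :=
  le_csSup (G.bddAbove_card_family _) ⟨F, hF, rfl⟩

end SimpleGraph

namespace SimpleGraph

variable {V : Type*} {G : SimpleGraph V}

/-! Let `S` be a `k`-set of edges of `G`, each represented by one of its ends, `r e`. The edges of a
path through all representatives, in order, form a path of the line graph; all edges at a vertex `w`
are mutually adjacent there, so the members of `S` represented at `w` can be inserted at the visit
to `w` (`exists_thread`). Edge-disjoint paths of `G` thus give paths of the line graph that meet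
only in `S`. They may still share an edge joining two members of `S` with the same representative.
If `C` is the number of elements of `S` in excess of distinct representatives, spending `C` further
paths on separating edges removes this conflict. So groups of `C + 1` paths yield one path each, and
one last path needs no separators (`lt_localPathConn_lineGraph`).

By Hall's theorem four edges have distinct representatives, so `C ≤ k - 4` for `k ≥ 5` and `C = 0`
otherwise; the loss is then below `2 ^ (k - 2)`, which is claim 1. Claim 2 follows since internally
disjoint paths are edge-disjoint.

For claim 3 with `k ≥ 3` the transfer is applied twice, the two excesses adding up to at most `k -
4` when `k ≥ 5`. For `k = 2` a factor two must be gained: every edge cut of the line graph has at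
least `2 * ω₂(G) - 2` edges (`two_mul_pathEdgeConn_two_le_card_cut`), and Menger's theorem, proved
by unit flows, turns this into paths. -/

/-! ### Paths from lists, and families of paths -/

theorem exists_walk_of_isChain {R : V → V → Prop} (hR : ∀ x y, R x y → G.Adj x y) :
    ∀ (l : List V) (a : V), (a :: l).IsChain R →
      ∃ (b : V) (p : G.Walk a b), p.support = a :: l ∧ ∀ d ∈ p.darts, R d.fst d.snd
  | [], a, _ => ⟨a, .nil, by simp, by simp⟩
  | c :: l, a, h => by
    rw [List.isChain_cons_cons] at h
    obtain ⟨b, p, hp, hd⟩ := exists_walk_of_isChain hR l c h.2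
    refine ⟨b, .cons (hR _ _ h.1) p, by simp [hp], ?_⟩
    intro d hd'
    rw [Walk.darts_cons, List.mem_cons] at hd'
    rcases hd' with rfl | hd'
    · exact h.1
    · exact hd d hd'

/-- A duplicate-free list whose consecutive members are related by a symmetric relation that
implies adjacency spans a path with all its edges in the relation. -/
theorem exists_isPathConnecting_of_isChain {R : V → V → Prop} (hsymm : ∀ x y, R x y → R y x)
    (hR : ∀ x y, R x y → G.Adj x y) {l : List V} (hne : l ≠ []) (hnd : l.Nodup)
    (hl : l.IsChain R) {S : Set V} (hS : ∀ x ∈ S, x ∈ l) :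
    ∃ P : G.Subgraph, G.IsPathConnecting S P ∧ P.verts = {x | x ∈ l} ∧
      ∀ x y, P.Adj x y → R x y := by
  obtain ⟨a, l, rfl⟩ := List.exists_cons_of_ne_nil hne
  obtain ⟨b, p, hp, hd⟩ := exists_walk_of_isChain hR l a hl
  refine ⟨p.toSubgraph, ⟨⟨a, b, p, ?_, rfl⟩, ?_⟩, ?_, ?_⟩
  · rw [Walk.isPath_def, hp]; exact hnd
  · intro x hx
    rw [Walk.mem_verts_toSubgraph, hp]
    exact hS x hx
  · rw [Walk.verts_toSubgraph, hp]
  · intro x y hxy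
    rw [← Subgraph.mem_edgeSet, Walk.mem_edges_toSubgraph, Walk.edges, List.mem_map] at hxy
    obtain ⟨d, hdp, hde⟩ := hxy
    have := hd d hdp
    replace hde : s(d.fst, d.snd) = s(x, y) := hde
    rw [Sym2.eq_iff] at hde
    rcases hde with ⟨h1, h2⟩ | ⟨h1, h2⟩
    · rw [← h1, ← h2]; exact this
    · rw [← h1, ← h2]; exact hsymm _ _ this

theorem exists_adj_of_isPathConnecting {S : Set V} {P : G.Subgraph} (hP : G.IsPathConnecting S P)
    {a b : V} (ha : a ∈ P.verts) (hb : b ∈ P.verts) (hab : a ≠ b) : ∃ c, P.Adj a c := by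
  obtain ⟨⟨u, v, p, hp, rfl⟩, hS⟩ := hP
  have hnt : (p.toSubgraph).Connected := p.toSubgraph_connected
  obtain ⟨q⟩ := hnt.preconnected ⟨a, ha⟩ ⟨b, hb⟩
  cases q with
  | nil => exact absurd rfl hab
  | cons h q => exact ⟨_, h⟩

theorem card_le_localPathConn [Finite V] {ι : Type*} [Fintype ι] {S : Set V} (hS : S.Nontrivial)
    (P : ι → G.Subgraph) (hP : ∀ i, G.IsPathConnecting S (P i))
    (hd : ∀ i j, i ≠ j → (∀ x y, (P i).Adj x y → ¬ (P j).Adj x y) ∧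
      (P i).verts ∩ (P j).verts ⊆ S) :
    Fintype.card ι ≤ G.localPathConn S := by
  classical
  have hinj : Function.Injective P := by
    intro i j hij
    by_contra hne
    obtain ⟨a, ha, b, hb, hab⟩ := hS
    obtain ⟨c, hc⟩ := exists_adj_of_isPathConnecting (hP i) ((hP i).2 ha) ((hP i).2 hb) hab
    exact (hd i j hne).1 a c hc (hij ▸ hc)
  have := G.le_localPathConn (S := S) (F := Finset.univ.image P) ⟨?_, ?_⟩
  · rwa [Finset.card_image_of_injective _ hinj, Finset.card_univ] at this
  · intro Q hQ
    obtain ⟨i, -, rfl⟩ := Finset.mem_image.1 hQ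
    exact hP i
  · intro Q hQ Q' hQ' hne
    obtain ⟨i, -, rfl⟩ := Finset.mem_image.1 hQ
    obtain ⟨j, -, rfl⟩ := Finset.mem_image.1 hQ'
    have hij : i ≠ j := fun h => hne (h ▸ rfl)
    refine ⟨?_, (hd i j hij).2.antisymm ?_⟩
    · rw [Set.eq_empty_iff_forall_notMem]
      rintro ⟨x, y⟩ ⟨h1, h2⟩
      exact (hd i j hij).1 x y h1 h2
    · exact Set.subset_inter (hP i).2 (hP j).2

/-! ### Threading edges into the edge sequence of a path -/

/-- The list of the edges of a walk, with the list `I v` inserted where the walk visits `v`. -/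
def Walk.lineList (I : V → List G.edgeSet) : ∀ {u v : V}, G.Walk u v → List G.edgeSet
  | u, _, .nil => I u
  | u, _, .cons h p => I u ++ ⟨s(u, _), h⟩ :: Walk.lineList I p

theorem Walk.mem_lineList {I : V → List G.edgeSet} {e : G.edgeSet} :
    ∀ {u v : V} (p : G.Walk u v),
      e ∈ p.lineList I ↔ e.1 ∈ p.edges ∨ ∃ w ∈ p.support, e ∈ I w
  | u, _, .nil => by simp [lineList]
  | u, _, .cons h p => by
    simp only [lineList, List.mem_append, List.mem_cons, mem_lineList p, edges_cons, support_cons,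
      exists_eq_or_imp, Subtype.ext_iff]
    tauto

theorem Walk.nodup_lineList {I : V → List G.edgeSet} (hI : ∀ v, (I v).Nodup)
    (hd : ∀ v w e, e ∈ I v → e ∈ I w → v = w) :
    ∀ {u v : V} (p : G.Walk u v), p.IsPath → (∀ w, ∀ e ∈ I w, e.1 ∉ p.edges) →
      (p.lineList I).Nodup
  | u, _, .nil, _, _ => hI u
  | u, _, .cons h p, hp, hpe => by
    have hp' := (cons_isPath_iff h p).1 hp
    have hedge := (isTrail_cons h p).1 hp.isTrail
    simp only [edges_cons, List.mem_cons, not_or] at hpe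
    simp only [lineList, List.nodup_append, List.nodup_cons, mem_lineList]
    refine ⟨hI u, ⟨?_, nodup_lineList hI hd p hp'.1 fun w e he => (hpe w e he).2⟩, ?_⟩
    · rintro (h1 | ⟨w, -, hw⟩)
      · exact hedge.2 h1
      · exact (hpe w _ hw).1 rfl
    · rintro e he e' he' rfl
      rw [List.mem_cons, mem_lineList] at he'
      rcases he' with rfl | h1 | ⟨w, hw, hew⟩
      · exact (hpe u _ he).1 rfl
      · exact (hpe u _ he).2 h1
      · exact hp'.2 (hd u w e he hew ▸ hw)

theorem Walk.isChain_cons_lineList {I : V → List G.edgeSet} {E : Set G.edgeSet}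
    {Q : G.edgeSet → G.edgeSet → Prop}
    (hQ : ∀ v, ∀ x ∈ E, ∀ y ∈ E, v ∈ x.1 → v ∈ y.1 → (x :: (I v ++ [y])).IsChain Q) :
    ∀ {u v : V} (p : G.Walk u v), (∀ e : G.edgeSet, e.1 ∈ p.edges → e ∈ E) →
      ∀ x ∈ E, u ∈ x.1 → (x :: p.lineList I).IsChain Q
  | u, _, .nil, _, x, hx, hu => by
    -- At the last vertex no edge follows; `x` serves as a dummy successor that is cut off again.
    have := hQ u x hx x hx hu hu
    rw [← List.cons_append] at this
    exact this.left_of_append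
  | u, _, .cons h p, hpe, x, hx, hu => by
    have he : (⟨s(u, _), h⟩ : G.edgeSet) ∈ E := hpe _ (by simp)
    rw [lineList, ← List.cons_append, List.isChain_split]
    refine ⟨hQ u x hx _ he hu (by simp), ?_⟩
    exact isChain_cons_lineList hQ p (fun e he => hpe e (by simp [he])) _ he (by simp)

theorem Walk.isChain_lineList {I : V → List G.edgeSet} {E : Set G.edgeSet}
    {Q : G.edgeSet → G.edgeSet → Prop}
    (hQ : ∀ v, ∀ x ∈ E, ∀ y ∈ E, v ∈ x.1 → v ∈ y.1 → (x :: (I v ++ [y])).IsChain Q)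
    {u v : V} (p : G.Walk u v) (hpe : ∀ e : G.edgeSet, e.1 ∈ p.edges → e ∈ E)
    (h0 : p.Nil → (I u).IsChain Q) : (p.lineList I).IsChain Q := by
  cases p with
  | nil => exact h0 .nil
  | cons h p =>
    have he : (⟨s(u, _), h⟩ : G.edgeSet) ∈ E := hpe _ (by simp)
    rw [lineList, List.isChain_split]
    exact ⟨(hQ u _ he _ he (by simp) (by simp)).tail,
      isChain_cons_lineList hQ p (fun e he => hpe e (by simp [he])) _ he (by simp)⟩

theorem isChain_and_of_pairwise {α : Type*} {R R' : α → α → Prop} :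
    ∀ {l : List α}, l.IsChain R → l.Pairwise R' → l.IsChain fun x y => R x y ∧ R' x y
  | [], _, _ => List.isChain_nil
  | [a], _, _ => List.isChain_singleton a
  | a :: b :: l, h, h' => by
    rw [List.isChain_cons_cons] at h ⊢
    rw [List.pairwise_cons] at h'
    exact ⟨⟨h.1, h'.1 b (by simp)⟩, isChain_and_of_pairwise h.2 h'.2⟩

/-- Adjacency of edges at a vertex at which each of them either is represented by `r` or belongs
to the edge set `E`; unless `b` holds, one of the two edges must belong to `E`. -/
def threadRel (r : G.edgeSet → V) (E : Set G.edgeSet) (b : Prop) (x y : G.edgeSet) : Prop :=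
  ((∃ v, (v ∈ x.1 ∧ (x ∈ E ∨ r x = v)) ∧ (v ∈ y.1 ∧ (y ∈ E ∨ r y = v))) ∧ (b ∨ x ∈ E ∨ y ∈ E)) ∧
    x ≠ y

theorem threadRel.symm {r : G.edgeSet → V} {E : Set G.edgeSet} {b : Prop} {x y : G.edgeSet}
    (h : threadRel r E b x y) : threadRel r E b y x := by
  obtain ⟨⟨⟨v, h1, h2⟩, h3⟩, h4⟩ := h
  exact ⟨⟨⟨v, h2, h1⟩, by tauto⟩, h4.symm⟩

theorem threadRel.adj {r : G.edgeSet → V} {E : Set G.edgeSet} {b : Prop} {x y : G.edgeSet}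
    (h : threadRel r E b x y) : G.lineGraph.Adj x y := by
  obtain ⟨⟨⟨v, h1, h2⟩, h3⟩, h4⟩ := h
  exact ⟨h4, v, h1.1, h2.1⟩

theorem eq_of_mem_of_ne {x y : G.edgeSet} (hxy : x ≠ y) {v w : V} (hvx : v ∈ x.1) (hvy : v ∈ y.1)
    (hwx : w ∈ x.1) (hwy : w ∈ y.1) : v = w := by
  by_contra h
  exact hxy (Subtype.ext (((Sym2.mem_and_mem_iff h).1 ⟨hvx, hwx⟩).trans
    ((Sym2.mem_and_mem_iff h).1 ⟨hvy, hwy⟩).symm))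

/-- Two distinct edges share only one vertex `v`. If one of them lies in `E`, hence not in `E'`,
both must be represented at `v`, against the uniqueness of representatives in `hE`. Only one of the
two relations has to forbid pairs outside its edge set, so one path of a family may be threaded
without separators. -/
theorem threadRel.not_threadRel {r : G.edgeSet → V} {S : Set G.edgeSet} {E E' : Set G.edgeSet}
    (hd : Disjoint E E') (hE : ∀ e ∈ E, e ∈ S → ∀ e' ∈ S, r e' = r e → e' = e) {b : Prop}
    {x y : G.edgeSet} (hx : x ∈ S) (hy : y ∈ S) (h : threadRel r E False x y) :
    ¬ threadRel r E' b x y := by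
  have key : ∀ x y : G.edgeSet, x ∈ S → y ∈ S → x ∈ E → threadRel r E False x y →
      threadRel r E' b x y → False := by
    rintro x y hx hy hxE ⟨⟨⟨v, h1, h2⟩, -⟩, h4⟩ ⟨⟨⟨w, h1', h2'⟩, -⟩, -⟩
    have hvw := eq_of_mem_of_ne h4 h1.1 h2.1 h1'.1 h2'.1
    subst hvw
    have hrx : r x = v := h1'.2.resolve_left (Set.disjoint_left.1 hd hxE)
    have hry : r y = v := by
      rcases h2.2 with hyE | h
      · exact h2'.2.resolve_left (Set.disjoint_left.1 hd hyE)
      · exact h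
    exact h4 (hE x hxE hx y hy (hry.trans hrx.symm)).symm
  intro h'
  rcases h.1.2 with h0 | hxE | hyE
  · exact h0
  · exact key x y hx hy hxE h h'
  · exact key y x hy hx hyE h.symm h'.symm

theorem isChain_cons_flatMap {α : Type*} {E : Set α} {b : Prop} {h : α → α} {y : α} (hy : y ∈ E) :
    ∀ (l : List α) (z : α), (∀ e ∈ l, h e ∈ E) →
      (z :: (l.flatMap (fun e => [h e, e]) ++ [y])).IsChain fun x y => b ∨ x ∈ E ∨ y ∈ E
  | [], z, _ => by simp [hy]
  | a :: l, z, hl => by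
    have ha : h a ∈ E := hl a (by simp)
    have := isChain_cons_flatMap (b := b) hy l a fun e he => hl e (by simp [he])
    simpa [ha] using this

-- At `w` the inserted list consists of the members of `S \ C` represented there, then each `c ∈ C`
-- preceded by its separator `h c`. Injectivity of `r` off `C` leaves at most one member of the
-- first kind, so no two neighbours both lie outside `E`. Members of `S` already in `E` are not
-- inserted again.
open Classical in
theorem exists_thread {S : Finset G.edgeSet} {r : G.edgeSet → V} (hr : ∀ e ∈ S, r e ∈ e.1)
    {C : Finset G.edgeSet} (hCS : C ⊆ S) {b : Prop}
    (hA : b ∨ Set.InjOn r (S \ C : Finset G.edgeSet)) {u v : V} {p : G.Walk u v} (hp : p.IsPath)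
    (hb : b ∨ ¬ p.Nil)
    (hs : ∀ e ∈ S, r e ∈ p.support) {h : G.edgeSet → G.edgeSet}
    (hh : ∀ e ∈ C, r e ∈ (h e).1 ∧ (h e).1 ∉ p.edges ∧ h e ∉ C) (hinj : Set.InjOn h C)
    (hC : ∀ e ∈ C, e.1 ∉ p.edges) {E : Set G.edgeSet} (hE : E = {e | e.1 ∈ p.edges} ∪ h '' C) :
    ∃ l : List G.edgeSet, l.Nodup ∧ l.IsChain (threadRel r E b) ∧ (∀ e ∈ S, e ∈ l) ∧
      ∀ e ∈ l, e ∈ E ∨ e ∈ S := by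
  set A : V → List G.edgeSet := fun w => ((S \ C).filter fun e => e ∉ E ∧ r e = w).toList with hAd
  set B : V → List G.edgeSet := fun w => (C.filter fun e => r e = w).toList with hBd
  set I : V → List G.edgeSet := fun w => A w ++ (B w).flatMap fun e => [h e, e] with hId
  have memA : ∀ w e, e ∈ A w ↔ (e ∈ S ∧ e ∉ C) ∧ e ∉ E ∧ r e = w := by
    intro w e; simp [hAd]
  have memB : ∀ w e, e ∈ B w ↔ e ∈ C ∧ r e = w := by
    intro w e; simp [hBd]
  have memI : ∀ w e, e ∈ I w ↔ e ∈ A w ∨ ∃ c ∈ B w, e = h c ∨ e = c := by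
    intro w e; simp [hId]
  have hEp : ∀ e : G.edgeSet, e.1 ∈ p.edges → e ∈ E := fun e he => hE ▸ Or.inl he
  have hEh : ∀ e ∈ C, h e ∈ E := fun e he => hE ▸ Or.inr ⟨e, he, rfl⟩
  have hCE : ∀ e ∈ C, e ∉ E := by
    intro e he heE
    rw [hE] at heE
    rcases heE with h1 | ⟨c, hc, rfl⟩
    · exact hC e he h1
    · exact (hh c hc).2.2 he
  have hIE : ∀ w, ∀ e ∈ I w, e.1 ∉ p.edges := by
    intro w e he hep
    rcases (memI w e).1 he with h1 | ⟨c, hc, rfl | rfl⟩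
    · exact ((memA w e).1 h1).2.1 (hEp e hep)
    · exact (hh c ((memB w c).1 hc).1).2.1 hep
    · exact hC _ ((memB w _).1 hc).1 hep
  have hφ : ∀ w, ∀ e ∈ I w, w ∈ e.1 ∧ (e ∈ E ∨ r e = w) := by
    intro w e he
    rcases (memI w e).1 he with h1 | ⟨c, hc, rfl | rfl⟩
    · obtain ⟨⟨h4, h2⟩, h3, rfl⟩ := (memA w e).1 h1
      exact ⟨hr e h4, Or.inr rfl⟩
    · obtain ⟨hcC, rfl⟩ := (memB w c).1 hc
      exact ⟨(hh c hcC).1, Or.inl (hEh c hcC)⟩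
    · obtain ⟨hcC, rfl⟩ := (memB w _).1 hc
      exact ⟨hr _ (hCS hcC), Or.inr rfl⟩
  have hIw : ∀ w w' e, e ∈ I w → e ∈ I w' → w = w' := by
    intro w w' e he he'
    rcases (memI w e).1 he with h1 | ⟨c, hc, rfl | rfl⟩
    · obtain ⟨⟨h4, h2⟩, h3, rfl⟩ := (memA w e).1 h1
      exact ((hφ w' e he').2.resolve_left h3)
    · obtain ⟨hcC, rfl⟩ := (memB w c).1 hc
      rcases (memI w' _).1 he' with h2 | ⟨c', hc', h2 | h2⟩
      · exact absurd (hEh c hcC) ((memA _ _).1 h2).2.1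
      · obtain ⟨hcC', rfl⟩ := (memB _ _).1 hc'
        rw [hinj hcC hcC' h2]
      · obtain ⟨hcC', rfl⟩ := (memB _ _).1 hc'
        exact absurd (h2 ▸ hcC') (hh c hcC).2.2
    · obtain ⟨hcC, rfl⟩ := (memB w _).1 hc
      exact ((hφ w' _ he').2.resolve_left (hCE _ hcC))
  have hIn : ∀ w, (I w).Nodup := by
    intro w
    rw [hId, List.nodup_append]
    refine ⟨Finset.nodup_toList _, ?_, ?_⟩
    · rw [List.nodup_flatMap]
      constructor
      · intro c hc
        have := (hh c ((memB w c).1 hc).1).2.2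
        have hne : h c ≠ c := fun h' => this (h'.symm ▸ ((memB w c).1 hc).1)
        simp [hne]
      · refine (Finset.nodup_toList _).pairwise_of_forall_ne ?_
        intro c hc c' hc' hne
        have hc := ((memB w c).1 hc).1
        have hc' := ((memB w c').1 hc').1
        have h1 : h c ≠ h c' := fun h' => hne (hinj hc hc' h')
        have h2 : h c ≠ c' := fun h' => (hh c hc).2.2 (h'.symm ▸ hc')
        have h3 : h c' ≠ c := fun h' => (hh c' hc').2.2 (h'.symm ▸ hc)
        simp [Function.onFun, h1.symm, h2.symm, h3, hne.symm]
    · rintro e he e' he' rfl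
      obtain ⟨c, hc, hce⟩ := List.mem_flatMap.1 he'
      have hc := ((memB w c).1 hc).1
      simp only [List.mem_cons, List.not_mem_nil, or_false] at hce
      rcases hce with rfl | rfl
      · exact ((memA w _).1 he).2.1 (hEh c hc)
      · exact ((memA w _).1 he).1.2 hc
  have hQ : ∀ w, ∀ x ∈ E, ∀ y ∈ E, w ∈ x.1 → w ∈ y.1 → (x :: (I w ++ [y])).IsChain
      fun x y => (b ∨ x ∈ E ∨ y ∈ E) ∧
        (∃ v, (v ∈ x.1 ∧ (x ∈ E ∨ r x = v)) ∧ (v ∈ y.1 ∧ (y ∈ E ∨ r y = v))) := by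
    intro w x hx y hy hwx hwy
    apply isChain_and_of_pairwise
    · by_cases hb : b
      · exact List.Pairwise.isChain (List.pairwise_of_forall fun _ _ => Or.inl hb)
      · have hA := hA.resolve_left hb
        have hB : ∀ e ∈ B w, h e ∈ E := fun e he => hEh e ((memB w e).1 he).1
        have hlen : ∀ e ∈ A w, ∀ e' ∈ A w, e = e' := by
          intro e he e' he'
          have h1 := (memA w e).1 he
          have h2 := (memA w e').1 he'
          exact hA (by simpa using h1.1) (by simpa using h2.1) (h1.2.2.trans h2.2.2.symm)
        have hnd : (A w).Nodup := Finset.nodup_toList _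
        rw [hId]
        -- At most one element stands before the first separator; the third case contradicts `hlen`.
        rcases hAw : A w with _ | ⟨a, _ | ⟨a', t⟩⟩
        · have := isChain_cons_flatMap (b := b) hy (B w) x hB
          simpa [hAw] using this
        · have := isChain_cons_flatMap (b := b) hy (B w) a hB
          simpa [hx, hAw] using this
        · rw [hAw] at hlen hnd
          have := hlen a (by simp) a' (by simp)
          simp [this] at hnd
    · have hall : ∀ e ∈ x :: (I w ++ [y]), w ∈ e.1 ∧ (e ∈ E ∨ r e = w) := by
        intro e he
        simp only [List.mem_cons, List.mem_append, List.not_mem_nil, or_false] at he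
        rcases he with rfl | he | rfl
        · exact ⟨hwx, Or.inl hx⟩
        · exact hφ w e he
        · exact ⟨hwy, Or.inl hy⟩
      rw [List.pairwise_iff_forall_sublist]
      intro c d hcd
      exact ⟨w, hall c (hcd.subset (by simp)), hall d (hcd.subset (by simp))⟩
  have h0 : p.Nil → (I u).IsChain fun x y => (b ∨ x ∈ E ∨ y ∈ E) ∧
        (∃ v, (v ∈ x.1 ∧ (x ∈ E ∨ r x = v)) ∧ (v ∈ y.1 ∧ (y ∈ E ∨ r y = v))) := by
    intro hnil
    apply List.Pairwise.isChain
    rw [List.pairwise_iff_forall_sublist]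
    intro c d hcd
    exact ⟨Or.inl (hb.resolve_right (not_not.2 hnil)), u, hφ u c (hcd.subset (by simp)),
      hφ u d (hcd.subset (by simp))⟩
  refine ⟨p.lineList I, ?_, ?_, ?_, ?_⟩
  · exact p.nodup_lineList hIn hIw hp hIE
  · have := isChain_and_of_pairwise (p.isChain_lineList hQ hEp h0)
      (p.nodup_lineList hIn hIw hp hIE)
    exact this.imp fun x y hxy => ⟨⟨hxy.1.2, hxy.1.1⟩, hxy.2⟩
  · intro e he
    rw [Walk.mem_lineList]
    by_cases hep : e.1 ∈ p.edges
    · exact Or.inl hep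
    right
    by_cases heC : e ∈ C
    · exact ⟨r e, hs e he, (memI _ _).2 (Or.inr ⟨e, (memB _ _).2 ⟨heC, rfl⟩, Or.inr rfl⟩)⟩
    by_cases heE : e ∈ E
    · rw [hE] at heE
      obtain ⟨c, hc, rfl⟩ := heE.resolve_left hep
      exact ⟨r c, hs c (hCS hc), (memI _ _).2 (Or.inr ⟨c, (memB _ _).2 ⟨hc, rfl⟩, Or.inl rfl⟩)⟩
    · exact ⟨r e, hs e he, (memI _ _).2 (Or.inl ((memA _ _).2 ⟨⟨he, heC⟩, heE, rfl⟩))⟩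
  · intro e he
    rcases (p.mem_lineList).1 he with h1 | ⟨w, -, hw⟩
    · exact Or.inl (hEp e h1)
    · rcases (memI w e).1 hw with h1 | ⟨c, hc, rfl | rfl⟩
      · exact Or.inr ((memA _ _).1 h1).1.1
      · exact Or.inl (hEh c ((memB _ _).1 hc).1)
      · exact Or.inr (hCS ((memB _ _).1 hc).1)

theorem exists_family_localPathEdgeConn [Finite V] (S : Set V) :
    ∃ F : Finset G.Subgraph, G.IsEdgeDisjointFamily S F ∧ F.card = G.localPathEdgeConn S := by
  have h := Nat.sSup_mem (s := {m : ℕ | ∃ F : Finset G.Subgraph,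
    G.IsEdgeDisjointFamily S F ∧ F.card = m}) ⟨0, ∅, by simp [IsEdgeDisjointFamily], rfl⟩
    (G.bddAbove_card_family _)
  exact h

theorem exists_isPathConnecting_of_thread {S : Finset G.edgeSet} (hS : S.Nonempty)
    {r : G.edgeSet → V} {E : Set G.edgeSet} {b : Prop}
    (h : ∃ l : List G.edgeSet, l.Nodup ∧ l.IsChain (threadRel r E b) ∧ (∀ e ∈ S, e ∈ l) ∧
      ∀ e ∈ l, e ∈ E ∨ e ∈ S) :
    ∃ P : G.lineGraph.Subgraph, G.lineGraph.IsPathConnecting S P ∧ (∀ e ∈ P.verts, e ∈ E ∨ e ∈ S) ∧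
      ∀ x y, P.Adj x y → threadRel r E b x y := by
  obtain ⟨l, h1, h2, h3, h4⟩ := h
  obtain ⟨e, he⟩ := hS
  obtain ⟨P, hP, hv, hPa⟩ := exists_isPathConnecting_of_isChain (S := (S : Set G.edgeSet))
    (fun x y => threadRel.symm) (fun x y => threadRel.adj) (List.ne_nil_of_mem (h3 e he)) h1 h2 h3
  refine ⟨P, hP, ?_, hPa⟩
  intro e he
  rw [hv] at he
  exact h4 e he

/-- With `A` a transversal, a conflicting element of `A` shares its representative with an element
of `S \ A`, and `r` is injective on `A`; the remaining conflicting elements lie in `S \ A`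
themselves. -/
theorem card_filter_not_unique_le {α β : Type*} [DecidableEq α] [DecidableEq β] {S A : Finset α}
    {r : α → β} (hinj : Set.InjOn r A)
    [DecidablePred fun e => ∃ e' ∈ S, e' ≠ e ∧ r e' = r e] :
    (S.filter fun e => ∃ e' ∈ S, e' ≠ e ∧ r e' = r e).card ≤ 2 * (S \ A).card := by
  set N := S.filter fun e => ∃ e' ∈ S, e' ≠ e ∧ r e' = r e
  have h1 : (N ∩ A).card ≤ (S \ A).card := by
    rw [← Finset.card_image_of_injOn (hinj.mono (by simp) : Set.InjOn r (N ∩ A : Finset α))]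
    refine (Finset.card_le_card ?_).trans (Finset.card_image_le (s := S \ A) (f := r))
    intro v hv
    obtain ⟨e, he, rfl⟩ := Finset.mem_image.1 hv
    rw [Finset.mem_inter, Finset.mem_filter] at he
    obtain ⟨⟨heS, e', he', hne, hre⟩, heA⟩ := he
    refine Finset.mem_image.2 ⟨e', Finset.mem_sdiff.2 ⟨he', fun h => hne (hinj h heA hre)⟩, hre⟩
  have h2 : N ⊆ (N ∩ A) ∪ (S \ A) := by
    intro e he
    by_cases heA : e ∈ A
    · simp [he, heA]
    · simp [heA, (Finset.mem_filter.1 he).1]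
  have h3 := (Finset.card_le_card h2).trans (Finset.card_union_le _ _)
  omega

/-! ### From edge-disjoint to internally disjoint paths -/

/-- A path of `G` through the representatives of the edges in `S` gives a path of the line graph
connecting `S`. -/
theorem exists_isPathConnecting_lineGraph {S : Finset G.edgeSet} (hS : S.Nonempty)
    {r : G.edgeSet → V} (hr : ∀ e ∈ S, r e ∈ e.1) {P : G.Subgraph}
    (hP : G.IsPathConnecting (r '' S) P) :
    ∃ E ⊆ {e : G.edgeSet | e.1 ∈ P.edgeSet}, ∃ Q : G.lineGraph.Subgraph,
      G.lineGraph.IsPathConnecting S Q ∧ (∀ e ∈ Q.verts, e ∈ E ∨ e ∈ S) ∧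
      ∀ x y, Q.Adj x y → threadRel r E True x y := by
  classical
  obtain ⟨⟨u, v, p, hp, rfl⟩, hPS⟩ := hP
  refine ⟨_, subset_rfl, exists_isPathConnecting_of_thread hS
    (exists_thread hr (C := ∅) (by simp) (Or.inl trivial) hp (Or.inl trivial) ?_ (h := id)
      (by simp) (by simp) (by simp) ?_)⟩
  · intro e he
    rw [← Walk.mem_verts_toSubgraph]
    exact hPS ⟨e, he, rfl⟩
  · ext e
    simp

/-- If `r` is injective on `S \ C`, then a path of `G` through the representatives of the edges in
`S`, together with one further path for each element of `C`, gives a path of the line graph that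
connects `S` and has no edge between two elements of `S` outside the given paths. -/
theorem exists_isPathConnecting_lineGraph_of_group {S : Finset G.edgeSet}
    {r : G.edgeSet → V} (hr : ∀ e ∈ S, r e ∈ e.1) {a b : G.edgeSet} (ha : a ∈ S) (hb : b ∈ S)
    (hab : r a ≠ r b) {C : Finset G.edgeSet} (hCS : C ⊆ S)
    (hA : Set.InjOn r (S \ C : Set G.edgeSet)) (P : Option C → G.Subgraph)
    (hP : ∀ o, G.IsPathConnecting (r '' S) (P o))
    (hd : ∀ o o', o ≠ o' → ∀ e ∈ (P o).edgeSet, e ∉ (P o').edgeSet)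
    (hC : ∀ o, ∀ e ∈ C, e.1 ∉ (P o).edgeSet) :
    ∃ E ⊆ {e : G.edgeSet | ∃ o, e.1 ∈ (P o).edgeSet}, ∃ Q : G.lineGraph.Subgraph,
      G.lineGraph.IsPathConnecting S Q ∧ (∀ e ∈ Q.verts, e ∈ E ∨ e ∈ S) ∧
      ∀ x y, Q.Adj x y → threadRel r E False x y := by
  classical
  -- Since there are two different representatives, no path is trivial, and each has an edge at
  -- every representative.
  have hex : ∀ o, ∀ e ∈ S, ∃ f : G.edgeSet, r e ∈ f.1 ∧ f.1 ∈ (P o).edgeSet := by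
    intro o e he
    have : ∃ e' ∈ S, r e ≠ r e' := by
      by_cases h : r e = r a
      · exact ⟨b, hb, h ▸ hab⟩
      · exact ⟨a, ha, h⟩
    obtain ⟨e', he', hne⟩ := this
    obtain ⟨c, hc⟩ := exists_adj_of_isPathConnecting (hP o) ((hP o).2 ⟨e, he, rfl⟩)
      ((hP o).2 ⟨e', he', rfl⟩) hne
    exact ⟨⟨s(r e, c), (P o).adj_sub hc⟩, by simp, hc⟩
  have hex' : ∀ e, ∃ f : G.edgeSet, ∀ he : e ∈ C, r e ∈ f.1 ∧ f.1 ∈ (P (some ⟨e, he⟩)).edgeSet := by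
    intro e
    by_cases he : e ∈ C
    · obtain ⟨f, hf⟩ := hex (some ⟨e, he⟩) e (hCS he)
      exact ⟨f, fun _ => hf⟩
    · exact ⟨e, fun h => absurd h he⟩
  choose h hh using hex'
  obtain ⟨⟨u, v, p, hp, hpP⟩, hPS⟩ := hP none
  have hedge : ∀ e, e ∈ p.edges ↔ e ∈ (P none).edgeSet := by
    intro e; rw [← hpP, Walk.mem_edges_toSubgraph]
  refine ⟨{e | e.1 ∈ p.edges} ∪ h '' C, ?_, exists_isPathConnecting_of_thread ⟨a, ha⟩
    (exists_thread hr hCS (Or.inr (by simpa using hA)) hp (Or.inr ?_) ?_ ?_ ?_ ?_ rfl)⟩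
  · rintro e (he | ⟨c, hc, rfl⟩)
    · exact ⟨none, (hedge _).1 he⟩
    · exact ⟨_, (hh c hc).2⟩
  · intro hnil
    obtain ⟨f, -, hf⟩ := hex none a ha
    rw [← hedge, Walk.edges_eq_nil.2 hnil] at hf
    simp at hf
  · intro e he
    rw [← Walk.mem_verts_toSubgraph, hpP]
    exact hPS ⟨e, he, rfl⟩
  · intro e he
    refine ⟨(hh e he).1, ?_, fun h' => hC _ _ h' (hh e he).2⟩
    rw [hedge]
    exact hd _ _ (by simp) _ (hh e he).2
  · intro e he e' he' hee
    by_contra hne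
    have := (hh e' he').2
    rw [← hee] at this
    exact hd _ _ (by simpa using hne) _ (hh e he).2 this
  · intro e he
    rw [hedge]
    exact hC _ e he

/-- A path is bad if it uses an edge of `S` whose representative is shared. There are at most `2 *
C` bad paths, so `h2` leaves `m` groups of `C + 1` good ones, and `h1` leaves one more path, good or
bad, for the thread without separators. -/
theorem lt_localPathConn_lineGraph [Finite V] {S : Finset G.edgeSet} {r : G.edgeSet → V}
    (hr : ∀ e ∈ S, r e ∈ e.1) [DecidableEq V] (hS : 2 ≤ (S.image r).card) {m C : ℕ}
    (hC : S.card ≤ (S.image r).card + C)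
    (h1 : m * (C + 1) < G.localPathEdgeConn (S.image r : Finset V))
    (h2 : 0 < m → m * (C + 1) + 2 * C ≤ G.localPathEdgeConn (S.image r : Finset V)) :
    m < G.lineGraph.localPathConn S := by
  classical
  obtain ⟨F, ⟨hFc, hFd⟩, hFcard⟩ :=
    G.exists_family_localPathEdgeConn ((S.image r : Finset V) : Set V)
  rw [← hFcard] at h1 h2
  rw [Finset.coe_image] at hFc
  obtain ⟨A, hAS, hAinj, hAim⟩ :=
    Finset.exists_subset_injOn_image_eq_of_surjOn S (S.image r) (f := r)
      (by intro x hx; simpa using hx)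
  have hAcard : A.card = (S.image r).card := by rw [← hAim, Finset.card_image_of_injOn hAinj]
  set D := S \ A with hD
  have hDcard : D.card ≤ C := by
    have : (S \ A).card + A.card = S.card :=
      Finset.card_sdiff_add_card_eq_card (Finset.coe_subset.1 hAS)
    rw [← hD] at this
    omega
  obtain ⟨_, ha', _, hb', hab⟩ := Finset.one_lt_card.1 hS
  obtain ⟨a, ha, rfl⟩ := Finset.mem_image.1 ha'
  obtain ⟨b, hb, rfl⟩ := Finset.mem_image.1 hb'
  set N := S.filter fun e => ∃ e' ∈ S, e' ≠ e ∧ r e' = r e with hN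
  have hNcard : N.card ≤ 2 * D.card := card_filter_not_unique_le hAinj
  have hDN : D ⊆ N := by
    intro e he
    obtain ⟨heS, heA⟩ := Finset.mem_sdiff.1 he
    have : r e ∈ A.image r := hAim ▸ Finset.mem_image_of_mem r heS
    obtain ⟨e', he', hre⟩ := Finset.mem_image.1 this
    exact Finset.mem_filter.2 ⟨heS, e', hAS he', fun h => heA (h ▸ he'), hre⟩
  set bad := F.filter fun P => ∃ e ∈ N, e.1 ∈ P.edgeSet with hbad
  -- Edge-disjointness makes the choice of a conflicting edge on each bad path injective.
  have hbadcard : bad.card ≤ N.card := by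
    have : ∀ P ∈ bad, ∃ e ∈ N, e.1 ∈ P.edgeSet := fun P hP => (Finset.mem_filter.1 hP).2
    have hnonempty : Nonempty G.edgeSet := ⟨a⟩
    choose! f hf using this
    refine Finset.card_le_card_of_injOn f (fun P hP => (hf P hP).1) ?_
    intro P hP Q hQ hPQ
    by_contra hne
    have := hFd P (Finset.mem_filter.1 hP).1 Q (Finset.mem_filter.1 hQ).1 hne
    refine (Set.eq_empty_iff_forall_notMem.1 this) (f P).1 ⟨(hf P hP).2, ?_⟩
    rw [hPQ]
    exact (hf Q hQ).2
  have hmD : m * (D.card + 1) ≤ m * (C + 1) := Nat.mul_le_mul_left _ (by omega)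
  have hgood : Fintype.card (Fin m × Option D) ≤ Fintype.card (F \ bad : Finset G.Subgraph) := by
    have h3 : (F \ bad).card + bad.card = F.card :=
      Finset.card_sdiff_add_card_eq_card (Finset.filter_subset _ _)
    simp only [Fintype.card_prod, Fintype.card_fin, Fintype.card_option, Fintype.card_coe]
    rcases Nat.eq_zero_or_pos m with rfl | hm
    · simp
    · have := h2 hm
      omega
  obtain ⟨g⟩ := Function.Embedding.nonempty_of_card_le hgood
  have hg : ∀ x, (g x).1 ∈ F ∧ ∀ e ∈ N, e.1 ∉ (g x).1.edgeSet := by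
    intro x
    have := Finset.mem_sdiff.1 (g x).2
    refine ⟨this.1, fun e he hex => this.2 (Finset.mem_filter.2 ⟨this.1, e, he, hex⟩)⟩
  obtain ⟨Q, hQF, hQ⟩ : ∃ Q ∈ F, ∀ x, (g x).1 ≠ Q := by
    by_contra! hcon
    have : F ⊆ Finset.univ.image fun x => (g x).1 := by
      intro Q hQ
      obtain ⟨x, hx⟩ := hcon Q hQ
      exact Finset.mem_image.2 ⟨x, Finset.mem_univ _, hx⟩
    have := (Finset.card_le_card this).trans Finset.card_image_le
    simp only [Finset.card_univ, Fintype.card_prod, Fintype.card_fin, Fintype.card_option,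
      Fintype.card_coe] at this
    omega
  have hdisj : ∀ P ∈ F, ∀ P' ∈ F, P ≠ P' → ∀ e ∈ P.edgeSet, e ∉ P'.edgeSet := fun P hP P' hP' hne
    e he he' => (Set.eq_empty_iff_forall_notMem.1 (hFd P hP P' hP' hne)) e ⟨he, he'⟩
  have hgd : ∀ x y, x ≠ y → ∀ e ∈ (g x).1.edgeSet, e ∉ (g y).1.edgeSet := fun x y hxy =>
    hdisj _ (hg x).1 _ (hg y).1 fun h => hxy (g.injective (Subtype.ext h))
  obtain ⟨E₀, hE₀, P₀, hP₀, hv₀, ha₀⟩ := exists_isPathConnecting_lineGraph ⟨a, ha⟩ hr (hFc Q hQF)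
  have hgroup := fun i : Fin m => exists_isPathConnecting_lineGraph_of_group hr ha hb hab
    (C := D) Finset.sdiff_subset
    (by rw [hD]; simpa [Set.inter_eq_right.2 (Finset.coe_subset.2 hAS)] using hAinj)
    (fun o => (g (i, o)).1)
    (fun o => hFc _ (hg _).1) (fun o o' hoo => hgd _ _ (by simpa using hoo))
    (fun o e he => (hg _).2 e (hDN he))
  choose E hE P hP hv hadj using hgroup
  have hEd : ∀ i j, i ≠ j → Disjoint (E i) (E j) := by
    intro i j hij
    rw [Set.disjoint_left]
    intro e hi hj
    obtain ⟨o, ho⟩ := hE i hi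
    obtain ⟨o', ho'⟩ := hE j hj
    exact hgd _ _ (by simp [hij]) _ ho ho'
  have hE₀d : ∀ i, Disjoint (E i) E₀ := by
    intro i
    rw [Set.disjoint_left]
    intro e hi hj
    obtain ⟨o, ho⟩ := hE i hi
    exact hdisj _ (hg _).1 _ hQF (hQ _) _ ho (hE₀ hj)
  -- This is where bad paths must be avoided: it is the uniqueness required by
  -- `threadRel.not_threadRel`.
  have hEgood : ∀ i, ∀ e ∈ E i, e ∈ (S : Set G.edgeSet) → ∀ e' ∈ (S : Set G.edgeSet),
      r e' = r e → e' = e := by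
    intro i e he heS e' he' hre
    by_contra hne
    obtain ⟨o, ho⟩ := hE i he
    exact (hg _).2 e (Finset.mem_filter.2 ⟨heS, e', he', hne, hre⟩) ho
  have hverts : ∀ {E E' : Set G.edgeSet} {P P' : G.lineGraph.Subgraph}, Disjoint E E' →
      (∀ e ∈ P.verts, e ∈ E ∨ e ∈ S) → (∀ e ∈ P'.verts, e ∈ E' ∨ e ∈ S) →
      P.verts ∩ P'.verts ⊆ S := by
    rintro E E' P P' hd h h' e ⟨he, he'⟩
    rcases h e he with h3 | h3
    · exact (h' e he').resolve_left (Set.disjoint_left.1 hd h3)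
    · exact h3
  have hadjs : ∀ {i : Fin m} {E' : Set G.edgeSet} {P' : G.lineGraph.Subgraph} {b : Prop},
      Disjoint (E i) E' → (∀ e ∈ P'.verts, e ∈ E' ∨ e ∈ S) →
      (∀ x y, P'.Adj x y → threadRel r E' b x y) → ∀ x y, (P i).Adj x y → ¬ P'.Adj x y := by
    intro i E' P' b hd hv' hadj' x y hxy hxy'
    have := hverts hd (hv i) hv'
    exact (hadj i x y hxy).not_threadRel hd (hEgood i) (this ⟨hxy.fst_mem, hxy'.fst_mem⟩)
      (this ⟨hxy.snd_mem, hxy'.snd_mem⟩) (hadj' x y hxy')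
  have hnt : (S : Set G.edgeSet).Nontrivial := ⟨a, ha, b, hb, fun h => hab (h ▸ rfl)⟩
  have hfin := card_le_localPathConn hnt (fun i : Option (Fin m) => i.elim P₀ P)
    (by rintro (_ | i); exacts [hP₀, hP i]) ?_
  · simpa using hfin
  · rintro (_ | i) (_ | j) hij
    · exact absurd rfl hij
    · refine ⟨fun x y hxy hxy' => hadjs (hE₀d j) hv₀ ha₀ x y hxy' hxy, ?_⟩
      exact hverts (hE₀d j).symm hv₀ (hv j)
    · exact ⟨hadjs (hE₀d i) hv₀ ha₀, hverts (hE₀d i) (hv i) hv₀⟩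
    · have hij' : i ≠ j := fun h => hij (h ▸ rfl)
      exact ⟨hadjs (hEd i j hij') (hv j) (hadj j), hverts (hEd i j hij') (hv i) (hv j)⟩

/-! ### Minima over `k`-sets -/

theorem exists_pathConn_eq [Finite V] {k : ℕ} (hk : k ≤ Nat.card V) :
    ∃ S : Finset V, S.card = k ∧ G.localPathConn (S : Set V) = G.pathConn k := by
  have := Fintype.ofFinite V
  rw [Nat.card_eq_fintype_card, ← Finset.card_univ] at hk
  obtain ⟨S, -, hS⟩ := Finset.exists_subset_card_eq hk
  exact Nat.sInf_mem (s := {m : ℕ | ∃ S : Finset V, S.card = k ∧ G.localPathConn (S : Set V) = m})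
    ⟨_, S, hS, rfl⟩

theorem exists_pathEdgeConn_eq [Finite V] {k : ℕ} (hk : k ≤ Nat.card V) :
    ∃ S : Finset V, S.card = k ∧ G.localPathEdgeConn (S : Set V) = G.pathEdgeConn k := by
  have := Fintype.ofFinite V
  rw [Nat.card_eq_fintype_card, ← Finset.card_univ] at hk
  obtain ⟨S, -, hS⟩ := Finset.exists_subset_card_eq hk
  exact Nat.sInf_mem
    (s := {m : ℕ | ∃ S : Finset V, S.card = k ∧ G.localPathEdgeConn (S : Set V) = m})
    ⟨_, S, hS, rfl⟩

theorem pathConn_le_localPathConn (S : Finset V) :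
    G.pathConn S.card ≤ G.localPathConn (S : Set V) :=
  Nat.sInf_le ⟨S, rfl, rfl⟩

theorem pathEdgeConn_le_localPathEdgeConn (S : Finset V) :
    G.pathEdgeConn S.card ≤ G.localPathEdgeConn (S : Set V) :=
  Nat.sInf_le ⟨S, rfl, rfl⟩

theorem localPathEdgeConn_anti [Finite V] {S T : Set V} (h : S ⊆ T) :
    G.localPathEdgeConn T ≤ G.localPathEdgeConn S := by
  obtain ⟨F, ⟨hF, hd⟩, hc⟩ := G.exists_family_localPathEdgeConn T
  rw [← hc]
  exact G.le_localPathEdgeConn ⟨fun P hP => ⟨(hF P hP).1, h.trans (hF P hP).2⟩, hd⟩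

theorem localPathConn_le_localPathEdgeConn [Finite V] (S : Set V) :
    G.localPathConn S ≤ G.localPathEdgeConn S := by
  refine csSup_le' ?_
  rintro m ⟨F, hF, rfl⟩
  exact G.le_localPathEdgeConn ⟨hF.1, fun P hP Q hQ h => (hF.2 P hP Q hQ h).1⟩

theorem pathEdgeConn_le_of_card_le [Finite V] {k : ℕ} (hk : k ≤ Nat.card V) {S : Finset V}
    (hS : S.card ≤ k) : G.pathEdgeConn k ≤ G.localPathEdgeConn (S : Set V) := by
  have := Fintype.ofFinite V
  rw [Nat.card_eq_fintype_card, ← Finset.card_univ] at hk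
  obtain ⟨T, hST, -, rfl⟩ := Finset.exists_subsuperset_card_eq (Finset.subset_univ S) hS hk
  exact (G.pathEdgeConn_le_localPathEdgeConn T).trans (localPathEdgeConn_anti (by simpa using hST))

theorem pathConn_le_pathEdgeConn [Finite V] {k : ℕ} (hk : k ≤ Nat.card V) :
    G.pathConn k ≤ G.pathEdgeConn k := by
  obtain ⟨S, rfl, hS⟩ := exists_pathEdgeConn_eq (G := G) hk
  rw [← hS]
  exact (pathConn_le_localPathConn S).trans (localPathConn_le_localPathEdgeConn _)

/-! ### Distinct representatives and numbers of edges -/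

/-- This is Hall's condition. Edges covering at most three vertices number at most `U.card.choose 2
≤ U.card`; otherwise the bound four suffices. It fails for five edges, which can lie on four
vertices. -/
theorem card_le_card_biUnion_toFinset [DecidableEq V] (s : Finset (Sym2 V))
    (hs : ∀ e ∈ s, ¬ e.IsDiag) (h4 : s.card ≤ 4) : s.card ≤ (s.biUnion Sym2.toFinset).card := by
  set U := s.biUnion Sym2.toFinset
  have hsub : s ⊆ U.offDiag.image Sym2.mk.uncurry := by
    intro e he
    have hd := hs e he
    have hU : ∀ x ∈ e, x ∈ U := fun x hx => Finset.mem_biUnion.2 ⟨e, he, by simpa using hx⟩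
    induction e with
    | h x y =>
      refine Finset.mem_image.2 ⟨(x, y), Finset.mem_offDiag.2 ⟨hU x (by simp), hU y (by simp), ?_⟩,
        rfl⟩
      simpa using hd
  have h := Finset.card_le_card hsub
  rw [Sym2.card_image_offDiag] at h
  by_contra! hlt
  have h3 : U.card ≤ 3 := by omega
  have hc : U.card.choose 2 ≤ U.card := by
    interval_cases U.card <;> decide
  omega

/-- Up to four edges have distinct representatives among their ends. -/
theorem exists_representatives [DecidableEq V] (S : Finset G.edgeSet) :
    ∃ r : G.edgeSet → V, (∀ e, r e ∈ e.1) ∧ min S.card 4 ≤ (S.image r).card := by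
  classical
  obtain ⟨A, hAS, hA⟩ := Finset.exists_subset_card_eq (min_le_left S.card 4)
  have hall : ∀ s : Finset A, s.card ≤ (s.biUnion fun e => e.1.1.toFinset).card := by
    intro s
    have hinj : Function.Injective fun e : A => e.1.1 :=
      Subtype.val_injective.comp Subtype.val_injective
    have := card_le_card_biUnion_toFinset (s.image fun e : A => e.1.1) ?_ ?_
    · rwa [Finset.card_image_of_injective _ hinj, Finset.image_biUnion] at this
    · intro e he
      obtain ⟨f, -, rfl⟩ := Finset.mem_image.1 he
      exact G.not_isDiag_of_mem_edgeSet f.1.2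
    · rw [Finset.card_image_of_injective _ hinj]
      have := Finset.card_le_univ s
      rw [Fintype.card_coe] at this
      omega
  obtain ⟨f, hf, hfm⟩ := (Finset.all_card_le_biUnion_card_iff_exists_injective _).1 hall
  refine ⟨fun e => if h : e ∈ A then f ⟨e, h⟩ else e.1.out.1, ?_, ?_⟩
  · intro e
    by_cases h : e ∈ A
    · simpa [h] using hfm ⟨e, h⟩
    · simpa [h] using Sym2.out_fst_mem e.1
  · rw [← hA]
    refine le_trans (le_of_eq ?_) (Finset.card_le_card (Finset.image_subset_image hAS))
    symm
    apply Finset.card_image_of_injOn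
    intro e he e' he' hee
    have he : e ∈ A := he
    have he' : e' ∈ A := he'
    simp only [he, he', dif_pos] at hee
    exact congrArg Subtype.val (hf hee)

/-- A graph with all degrees at least two has no more vertices than edges. -/
theorem card_le_card_edgeSet [Finite V] (h : ∀ v, ∃ a b, a ≠ b ∧ G.Adj v a ∧ G.Adj v b) :
    Nat.card V ≤ Nat.card G.edgeSet := by
  classical
  have := Fintype.ofFinite V
  rw [Nat.card_eq_fintype_card, Nat.card_eq_fintype_card, ← edgeFinset_card]
  have h1 := G.sum_degrees_eq_twice_card_edges
  have h2 : ∑ v : V, 2 ≤ ∑ v, G.degree v := by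
    refine Finset.sum_le_sum fun v _ => ?_
    obtain ⟨a, b, hab, ha, hb⟩ := h v
    rw [← card_neighborFinset_eq_degree]
    exact Finset.one_lt_card.2 ⟨a, by simpa using ha, b, by simpa using hb, hab⟩
  simp only [Finset.sum_const, Finset.card_univ, smul_eq_mul] at h2
  omega

theorem lineGraph_exists_two_adj (h : ∀ v, ∃ a b, a ≠ b ∧ G.Adj v a ∧ G.Adj v b)
    (e : G.edgeSet) : ∃ f g, f ≠ g ∧ G.lineGraph.Adj e f ∧ G.lineGraph.Adj e g := by
  have key : ∀ v w, ∃ a, a ≠ w ∧ G.Adj v a := by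
    intro v w
    obtain ⟨a, b, hab, ha, hb⟩ := h v
    by_cases haw : a = w
    · exact ⟨b, fun hbw => hab (haw.trans hbw.symm), hb⟩
    · exact ⟨a, haw, ha⟩
  obtain ⟨⟨u, v⟩, he⟩ := e
  have huv : G.Adj u v := he
  obtain ⟨a, hav, ha⟩ := key u v
  obtain ⟨b, hbu, hb⟩ := key v u
  have h1 := huv.ne
  refine ⟨⟨s(u, a), ha⟩, ⟨s(v, b), hb⟩, ?_, ⟨?_, u, ?_, ?_⟩, ⟨?_, v, ?_, ?_⟩⟩
  · intro h
    replace h : s(u, a) = s(v, b) := congrArg Subtype.val h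
    rw [Sym2.eq_iff] at h
    rcases h with ⟨h, -⟩ | ⟨h, -⟩
    · exact h1 h
    · exact hbu h.symm
  · intro h
    replace h : s(u, v) = s(u, a) := congrArg Subtype.val h
    rw [Sym2.eq_iff] at h
    rcases h with ⟨-, h⟩ | ⟨h, h'⟩
    · exact hav h.symm
    · exact h1 h'.symm
  · exact Sym2.mem_mk_left u v
  · exact Sym2.mem_mk_left u a
  · intro h
    replace h : s(u, v) = s(v, b) := congrArg Subtype.val h
    rw [Sym2.eq_iff] at h
    rcases h with ⟨h, -⟩ | ⟨h, h'⟩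
    · exact h1 h
    · exact hbu h.symm
  · exact Sym2.mem_mk_right u v
  · exact Sym2.mem_mk_left v b

/-! ### Numerical bounds: claim 1, and claim 3 for `k ≥ 3` -/

/-- Bound for the number of edge-disjoint paths through the representatives of `S` in terms of the
number of internally disjoint paths connecting `S` in the line graph. -/
theorem localPathEdgeConn_le_of_lineGraph [Finite V] [DecidableEq V] {S : Finset G.edgeSet}
    {r : G.edgeSet → V} (hr : ∀ e ∈ S, r e ∈ e.1) (hS : 2 ≤ (S.image r).card) {m C : ℕ}
    (hC : S.card ≤ (S.image r).card + C) (hm : G.lineGraph.localPathConn S ≤ m) :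
    G.localPathEdgeConn (S.image r : Finset V) ≤ m * (C + 1) + (2 * C - 1) ∧
      (m = 0 ∨ C = 0 → G.localPathEdgeConn (S.image r : Finset V) ≤ m) := by
  have key : ¬ (m * (C + 1) < G.localPathEdgeConn (S.image r : Finset V) ∧
      (0 < m → m * (C + 1) + 2 * C ≤ G.localPathEdgeConn (S.image r : Finset V))) := fun h =>
    absurd (lt_localPathConn_lineGraph hr hS hC h.1 h.2) (by omega)
  rcases Nat.eq_zero_or_pos m with rfl | hm
  · simp only [Nat.zero_mul, lt_self_iff_false, false_imp_iff, and_true] at key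
    constructor <;> [skip; intro _] <;> omega
  · refine ⟨?_, ?_⟩
    · by_contra hcon
      exact key ⟨by omega, fun _ => by omega⟩
    · rintro (h | rfl)
      · omega
      · by_contra hcon
        exact key ⟨by omega, fun _ => by omega⟩

theorem mul_add_le_two_pow_mul {k m C : ℕ} (hk : 5 ≤ k) (hC : C ≤ k - 4) (hm : 0 < m) :
    m * (C + 1) + (2 * C - 1) ≤ 2 ^ (k - 2) * m := by
  have h1 : 3 * (k - 4) + 1 ≤ 2 ^ (k - 2) := by
    obtain ⟨j, rfl⟩ := Nat.exists_eq_add_of_le hk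
    have : j < 2 ^ j := Nat.lt_two_pow_self
    have h8 : 2 ^ (5 + j - 2) = 8 * 2 ^ j := by
      rw [show 5 + j - 2 = 3 + j by omega, pow_add]; norm_num
    omega
  calc m * (C + 1) + (2 * C - 1) ≤ m * (C + 1) + m * (2 * C) := by
        have : 2 * C ≤ m * (2 * C) := Nat.le_mul_of_pos_left _ hm
        omega
    _ = m * (3 * C + 1) := by ring
    _ ≤ m * 2 ^ (k - 2) := Nat.mul_le_mul_left _ (by omega)
    _ = _ := by ring

theorem pathEdgeConn_le_two_pow_mul [Finite V] {k : ℕ} (hk : 2 ≤ k) (hkV : k ≤ Nat.card V)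
    (hkE : k ≤ Nat.card G.edgeSet) :
    G.pathEdgeConn k ≤ 2 ^ (k - 2) * G.lineGraph.pathConn k := by
  classical
  obtain ⟨S, hSk, hS⟩ := exists_pathConn_eq (G := G.lineGraph) hkE
  obtain ⟨r, hr, hcard⟩ := exists_representatives S
  rw [← hS]
  refine (pathEdgeConn_le_of_card_le (S := S.image r) hkV (by
    rw [← hSk]; exact Finset.card_image_le)).trans ?_
  obtain ⟨h1, h2⟩ := localPathEdgeConn_le_of_lineGraph (S := S) (r := r) (fun e _ => hr e) (by omega)
    (C := k - min k 4) (by omega) le_rfl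
  have hpos : 1 ≤ 2 ^ (k - 2) := Nat.one_le_two_pow
  by_cases h : G.lineGraph.localPathConn S = 0 ∨ k - min k 4 = 0
  · exact (h2 h).trans (Nat.le_mul_of_pos_left _ hpos)
  · push Not at h
    exact h1.trans (mul_add_le_two_pow_mul (by omega) (by omega) (by omega))

theorem four_mul_le_sq (a b : ℕ) : 4 * ((a + 1) * (b + 1)) ≤ (a + b + 2) ^ 2 := by
  zify
  nlinarith [sq_nonneg ((a : ℤ) - b)]

/-- Combined with `four_mul_le_sq` it gives `3 * p ≤ 2 ^ (j + 4) + 3` for the product `p` of the two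
group sizes; this is exactly what the case `m = 1` below needs. -/
theorem three_mul_sq_le (j : ℕ) : 3 * (j + 5) ^ 2 ≤ 4 * (2 ^ (j + 4) + 3) := by
  induction j with
  | zero => norm_num
  | succ j ih =>
    have h : 2 ^ (j + 1 + 4) = 2 * 2 ^ (j + 4) := by ring
    rw [h]
    have : j < 2 ^ j := Nat.lt_two_pow_self
    have h' : 2 ^ (j + 4) = 16 * 2 ^ j := by ring
    nlinarith

theorem mul_add_mul_add_le_two_pow_mul {k m a b : ℕ} (hk : 5 ≤ k) (hab : a + b ≤ k - 4) (hm : 0 < m) :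
    (m * (a + 1) + (2 * a - 1)) * (b + 1) + (2 * b - 1) ≤ 2 ^ (k - 3) * m + 1 := by
  obtain ⟨j, rfl⟩ := Nat.exists_eq_add_of_le hk
  -- The cases `k = 5` and `k = 6` are checked directly: the estimate by `m * p + 2 * p - 2` is too
  -- weak for `k = 6`, `a = b = 1`, `m = 1`.
  rcases j with _ | _ | j
  · have ha : a ≤ 1 := by omega
    have hb : b ≤ 1 := by omega
    interval_cases a <;> interval_cases b <;> simp at hab ⊢ <;> omega
  · have ha : a ≤ 2 := by omega
    have hb : b ≤ 2 := by omega
    interval_cases a <;> interval_cases b <;> simp at hab ⊢ <;> omega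
  · set p := (a + 1) * (b + 1) with hp
    have h1 : 4 * p ≤ (j + 5) ^ 2 :=
      (four_mul_le_sq a b).trans (Nat.pow_le_pow_left (by omega) 2)
    have h2 := three_mul_sq_le j
    have h3 : 5 + (j + 1 + 1) - 3 = j + 4 := by omega
    rw [h3]
    have h4 : (m * (a + 1) + (2 * a - 1)) * (b + 1) + (2 * b - 1) ≤ m * p + 2 * p - 2 := by
      have : (m * (a + 1) + 2 * a) * (b + 1) + 2 * b + 2 = m * p + 2 * p := by rw [hp]; ring
      have h5 : (m * (a + 1) + (2 * a - 1)) * (b + 1) ≤ (m * (a + 1) + 2 * a) * (b + 1) :=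
        Nat.mul_le_mul_right _ (by omega)
      omega
    refine h4.trans ?_
    obtain ⟨n, rfl⟩ := Nat.exists_eq_add_of_le hm
    have h6 : 3 * p ≤ 2 ^ (j + 4) + 3 := by omega
    have h16 : 2 ^ (j + 4) = 16 * 2 ^ j := by ring
    have hpos : 1 ≤ 2 ^ j := Nat.one_le_two_pow
    have h7 : p ≤ 2 ^ (j + 4) := by omega
    have h8 : n * p ≤ n * 2 ^ (j + 4) := Nat.mul_le_mul_left _ h7
    have h9 : (Nat.succ 0 + n) * p = p + n * p := by ring
    have h10 : 2 ^ (j + 4) * (Nat.succ 0 + n) = 2 ^ (j + 4) + n * 2 ^ (j + 4) := by ring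
    omega

theorem pathConn_le_of_lineGraph_lineGraph [Finite V] {k : ℕ} (hk : 3 ≤ k) (hkV : k ≤ Nat.card V)
    (hkE : k ≤ Nat.card G.lineGraph.edgeSet) :
    G.pathConn k ≤ 2 ^ (k - 3) * G.lineGraph.lineGraph.pathConn k + 1 := by
  classical
  obtain ⟨S, hSk, hS⟩ := exists_pathConn_eq (G := G.lineGraph.lineGraph) hkE
  obtain ⟨r, hr, hcard⟩ := exists_representatives S
  set B := S.image r with hB
  have hBS : B.card ≤ S.card := Finset.card_image_le
  obtain ⟨q, hq, hqcard⟩ := exists_representatives B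
  have hqB : (B.image q).card ≤ B.card := Finset.card_image_le
  rw [← hS]
  set m := G.lineGraph.lineGraph.localPathConn S
  obtain ⟨h1, h2⟩ := localPathEdgeConn_le_of_lineGraph (S := S) (r := r) (fun e _ => hr e)
    (by rw [← hB]; omega) (C := k - B.card) (by rw [← hB]; omega) (le_refl m)
  rw [← hB] at h1 h2
  have hle := localPathConn_le_localPathEdgeConn (G := G.lineGraph) B
  have h3 := fun {n} (hn : G.lineGraph.localPathEdgeConn B ≤ n) =>
    localPathEdgeConn_le_of_lineGraph (S := B) (r := q) (fun e _ => hq e) (by omega)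
      (C := B.card - (B.image q).card) (by omega) (hle.trans hn)
  have h4 : G.pathConn k ≤ G.localPathEdgeConn (B.image q : Finset V) :=
    (pathConn_le_pathEdgeConn hkV).trans (pathEdgeConn_le_of_card_le hkV (by omega))
  have hpos : 1 ≤ 2 ^ (k - 3) := Nat.one_le_two_pow
  -- For `k ≤ 4` both excesses vanish; for `m = 0` the first transfer gives zero, and so does the
  -- second.
  by_cases h : m = 0 ∨ k ≤ 4
  · have h5 := (h3 (h2 (by omega))).2 (by omega)
    have := Nat.le_mul_of_pos_left m hpos
    omega
  · push Not at h
    exact (h4.trans (h3 h1).1).trans (mul_add_mul_add_le_two_pow_mul (by omega) (by omega) (by omega))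

/-! ### Unit flows and Menger's theorem -/

/-- `φ` is an integral flow of value `m` from `s` to `t` with unit capacities on the edges. -/
structure IsUnitFlow [Fintype V] [DecidableEq V] (G : SimpleGraph V) (s t : V) (m : ℤ)
    (φ : V → V → ℤ) : Prop where
  antisymm : ∀ u w, φ u w = - φ w u
  le_one : ∀ u w, φ u w ≤ 1
  eq_zero : ∀ u w, ¬ G.Adj u w → φ u w = 0
  sum_eq : ∀ u, ∑ w, φ u w = (if u = s then m else 0) - (if u = t then m else 0)

/-- The unit flow along a walk. -/
def Walk.flow [DecidableEq V] : ∀ {u v : V}, G.Walk u v → V → V → ℤ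
  | _, _, .nil => 0
  | u, _, .cons (v := w) _ p => fun x y =>
    ((if x = u ∧ y = w then 1 else 0) - (if x = w ∧ y = u then 1 else 0)) + p.flow x y

theorem Walk.flow_antisymm [DecidableEq V] :
    ∀ {u v : V} (p : G.Walk u v) (x y : V), p.flow x y = - p.flow y x
  | _, _, .nil, x, y => by simp [flow]
  | u, _, .cons (v := w) h p, x, y => by
    simp only [flow]
    rw [flow_antisymm p x y]
    split_ifs <;> first | omega | (exfalso; tauto)

theorem Walk.sum_flow [Fintype V] [DecidableEq V] :
    ∀ {u v : V} (p : G.Walk u v) (x : V),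
      ∑ y, p.flow x y = (if x = u then 1 else 0) - (if x = v then 1 else 0)
  | _, _, .nil, x => by simp [flow]
  | u, v, .cons (v := w) h p, x => by
    simp only [flow, Finset.sum_add_distrib, Finset.sum_sub_distrib, sum_flow p x, ite_and]
    by_cases h1 : x = u <;> by_cases h2 : x = w <;> simp [h1, h2]

theorem Walk.flow_cases [DecidableEq V] :
    ∀ {u v : V} (p : G.Walk u v), p.IsTrail → ∀ x y : V,
      (s(x, y) ∉ p.edges ∧ p.flow x y = 0) ∨
      ((∃ d ∈ p.darts, d.fst = x ∧ d.snd = y) ∧ p.flow x y = 1) ∨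
      ((∃ d ∈ p.darts, d.fst = y ∧ d.snd = x) ∧ p.flow x y = -1)
  | _, _, .nil, _, x, y => by simp [flow]
  | u, _, .cons (v := w) h p, hp, x, y => by
    rw [isTrail_cons] at hp
    have hne := h.ne
    have ih := flow_cases p hp.1 x y
    simp only [flow, edges_cons, darts_cons, List.mem_cons, exists_eq_or_imp]
    by_cases h1 : x = u ∧ y = w
    · obtain ⟨rfl, rfl⟩ := h1
      rcases ih with h2 | ⟨⟨d, hd, h2, h3⟩, -⟩ | ⟨⟨d, hd, h2, h3⟩, -⟩
      · right; left; simp [h2.2, hne]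
      · exact absurd (List.mem_map.2 ⟨d, hd, by rw [← h2, ← h3]; rfl⟩) hp.2
      · exact absurd (List.mem_map.2 ⟨d, hd, by rw [← h2, ← h3, Sym2.eq_swap]; rfl⟩) hp.2
    · by_cases h1' : x = w ∧ y = u
      · obtain ⟨rfl, rfl⟩ := h1'
        rcases ih with h2 | ⟨⟨d, hd, h2, h3⟩, -⟩ | ⟨⟨d, hd, h2, h3⟩, -⟩
        · right; right; simp [h2.2, hne.symm]
        · exact absurd (List.mem_map.2 ⟨d, hd, by rw [← h2, ← h3, Sym2.eq_swap]; rfl⟩) hp.2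
        · exact absurd (List.mem_map.2 ⟨d, hd, by rw [← h2, ← h3]; rfl⟩) hp.2
      · rw [if_neg h1, if_neg h1', sub_zero, zero_add]
        rcases ih with h2 | h2 | h2
        · left
          refine ⟨?_, h2.2⟩
          rw [Sym2.eq_iff]
          tauto
        · exact Or.inr (Or.inl ⟨Or.inr h2.1, h2.2⟩)
        · exact Or.inr (Or.inr ⟨Or.inr h2.1, h2.2⟩)

theorem exists_isPath_of_reflTransGen {R : V → V → Prop} (hR : ∀ x y, R x y → G.Adj x y) {s t : V}
    (h : Relation.ReflTransGen R s t) :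
    ∃ p : G.Walk s t, p.IsPath ∧ ∀ d ∈ p.darts, R d.fst d.snd := by
  classical
  obtain ⟨p, hp⟩ : ∃ p : G.Walk s t, ∀ d ∈ p.darts, R d.fst d.snd := by
    induction h using Relation.ReflTransGen.head_induction_on with
    | refl => exact ⟨.nil, by simp⟩
    | head hab _ ih =>
      obtain ⟨p, hp⟩ := ih
      refine ⟨.cons (hR _ _ hab) p, ?_⟩
      intro d hd
      rw [Walk.darts_cons, List.mem_cons] at hd
      rcases hd with rfl | hd
      · exact hab
      · exact hp d hd
  exact ⟨p.bypass, p.bypass_isPath, fun d hd => hp d (p.darts_bypass_subset_darts hd)⟩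

section Flow

variable [Fintype V] [DecidableEq V] {s t : V} {m : ℤ} {φ : V → V → ℤ}

theorem IsUnitFlow.value_eq (h : G.IsUnitFlow s t m φ) {X : Finset V} (hs : s ∈ X) (ht : t ∉ X) :
    m = ∑ u ∈ X, ∑ w ∈ Xᶜ, φ u w := by
  have h1 : ∑ u ∈ X, ∑ w, φ u w = m := by
    simp only [h.sum_eq, Finset.sum_sub_distrib, Finset.sum_ite_eq', hs, ht, if_true, if_false,
      sub_zero]
  have h2 : ∑ u ∈ X, ∑ w ∈ X, φ u w = 0 := by
    have : ∑ u ∈ X, ∑ w ∈ X, φ u w = - ∑ u ∈ X, ∑ w ∈ X, φ u w := by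
      conv_lhs => rw [Finset.sum_comm]
      rw [← Finset.sum_neg_distrib]
      refine Finset.sum_congr rfl fun u _ => ?_
      rw [← Finset.sum_neg_distrib]
      exact Finset.sum_congr rfl fun w _ => h.antisymm w u
    omega
  rw [← h1]
  simp only [← Finset.sum_add_sum_compl X, Finset.sum_add_distrib, h2, zero_add]

theorem IsUnitFlow.add_walk (h : G.IsUnitFlow s t m φ) {p : G.Walk s t} (hp : p.IsPath)
    (hd : ∀ d ∈ p.darts, φ d.fst d.snd ≤ 0) :
    G.IsUnitFlow s t (m + 1) (fun x y => φ x y + p.flow x y) where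
  antisymm u w := by rw [h.antisymm u w, p.flow_antisymm u w]; ring
  le_one u w := by
    rcases p.flow_cases hp.isTrail u w with h1 | ⟨⟨d, hdp, rfl, rfl⟩, h1⟩ | ⟨-, h1⟩
    · rw [h1.2]; have := h.le_one u w; omega
    · rw [h1]; have := hd d hdp; omega
    · rw [h1]; have := h.le_one u w; omega
  eq_zero u w huw := by
    rcases p.flow_cases hp.isTrail u w with h1 | ⟨⟨d, hdp, rfl, rfl⟩, h1⟩ | ⟨⟨d, hdp, rfl, rfl⟩, h1⟩
    · rw [h1.2, h.eq_zero u w huw]; rfl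
    · exact absurd d.adj huw
    · exact absurd d.adj.symm huw
  sum_eq u := by
    rw [Finset.sum_add_distrib, h.sum_eq, p.sum_flow]
    split_ifs <;> ring

theorem IsUnitFlow.sub_walk (h : G.IsUnitFlow s t m φ) {p : G.Walk s t} (hp : p.IsPath)
    (hd : ∀ d ∈ p.darts, 0 < φ d.fst d.snd) :
    G.IsUnitFlow s t (m - 1) (fun x y => φ x y - p.flow x y) where
  antisymm u w := by rw [h.antisymm u w, p.flow_antisymm u w]; ring
  le_one u w := by
    rcases p.flow_cases hp.isTrail u w with h1 | ⟨-, h1⟩ | ⟨⟨d, hdp, rfl, rfl⟩, h1⟩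
    · rw [h1.2]; have := h.le_one u w; omega
    · rw [h1]; have := h.le_one u w; omega
    · rw [h1]; have := hd d hdp; have := h.antisymm d.fst d.snd; omega
  eq_zero u w huw := by
    rcases p.flow_cases hp.isTrail u w with h1 | ⟨⟨d, hdp, rfl, rfl⟩, h1⟩ | ⟨⟨d, hdp, rfl, rfl⟩, h1⟩
    · rw [h1.2, h.eq_zero u w huw]; rfl
    · exact absurd d.adj huw
    · exact absurd d.adj.symm huw
  sum_eq u := by
    rw [Finset.sum_sub_distrib, h.sum_eq, p.sum_flow]
    split_ifs <;> ring

-- Augmentation: if no residual path leads from `s` to `t`, the set reachable from `s` has all its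
-- outgoing edges saturated, so its cut has size `j`, less than `n`.
open Classical in
theorem exists_isUnitFlow {n : ℕ}
    (hcut : ∀ X : Finset V, s ∈ X → t ∉ X → n ≤ ((X ×ˢ Xᶜ).filter fun e => G.Adj e.1 e.2).card) :
    ∀ j ≤ n, ∃ φ, G.IsUnitFlow s t j φ
  | 0, _ => ⟨0, by simp, by simp, by simp, by simp⟩
  | j + 1, hj => by
    obtain ⟨φ, hφ⟩ := exists_isUnitFlow hcut j (by omega)
    set R : V → V → Prop := fun u w => G.Adj u w ∧ φ u w ≤ 0 with hR
    by_cases ht : Relation.ReflTransGen R s t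
    · obtain ⟨p, hp, hd⟩ := exists_isPath_of_reflTransGen (fun x y h => h.1) ht
      exact ⟨_, by exact_mod_cast hφ.add_walk hp fun d hdp => (hd d hdp).2⟩
    · exfalso
      set X : Finset V := Finset.univ.filter fun w => Relation.ReflTransGen R s w with hX
      have hsX : s ∈ X := by simp [hX, Relation.ReflTransGen.refl]
      have htX : t ∉ X := by simpa [hX] using ht
      have h1 := hφ.value_eq hsX htX
      have h2 := hcut X hsX htX
      have h3 : ∑ u ∈ X, ∑ w ∈ Xᶜ, φ u w =
          (((X ×ˢ Xᶜ).filter fun e => G.Adj e.1 e.2).card : ℤ) := by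
        rw [Finset.card_filter, Finset.sum_product, Nat.cast_sum]
        refine Finset.sum_congr rfl fun u hu => ?_
        rw [Nat.cast_sum]
        refine Finset.sum_congr rfl fun w hw => ?_
        by_cases hadj : G.Adj u w
        · have hnR : ¬ R u w := by
            intro hRuw
            simp only [hX, Finset.mem_compl, Finset.mem_filter, Finset.mem_univ, true_and] at hu hw
            exact hw (hu.tail hRuw)
          have := hφ.le_one u w
          have h0 : ¬ φ u w ≤ 0 := fun h0 => hnR ⟨hadj, h0⟩
          simp only [hadj, if_true]
          omega
        · simp [hadj, hφ.eq_zero u w hadj]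
      omega

/-- A path of positive flow is split off repeatedly. After subtraction the flow vanishes on its
edges, while later paths use only edges of nonzero flow, so edge-disjointness is automatic; leftover
circulations do no harm. -/
theorem IsUnitFlow.exists_family (hst : s ≠ t) : ∀ (n : ℕ) (φ : V → V → ℤ),
    G.IsUnitFlow s t n φ → ∃ F : Finset G.Subgraph, F.card = n ∧
      (∀ P ∈ F, (∃ p : G.Walk s t, p.IsPath ∧ p.toSubgraph = P) ∧
        ∀ x y, P.Adj x y → φ x y ≠ 0) ∧
      ∀ P ∈ F, ∀ Q ∈ F, P ≠ Q → P.edgeSet ∩ Q.edgeSet = ∅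
  | 0, _, _ => ⟨∅, by simp⟩
  | n + 1, φ, hφ => by
    classical
    set R : V → V → Prop := fun u w => 0 < φ u w with hR
    have hRadj : ∀ x y, R x y → G.Adj x y := by
      intro x y h
      by_contra hadj
      have h : 0 < φ x y := h
      rw [hφ.eq_zero x y hadj] at h
      omega
    have ht : Relation.ReflTransGen R s t := by
      by_contra ht
      set X : Finset V := Finset.univ.filter fun w => Relation.ReflTransGen R s w with hX
      have h1 := hφ.value_eq (X := X) (by simp [hX, Relation.ReflTransGen.refl])
        (by simpa [hX] using ht)
      have h2 : ∑ u ∈ X, ∑ w ∈ Xᶜ, φ u w ≤ 0 := by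
        refine Finset.sum_nonpos fun u hu => Finset.sum_nonpos fun w hw => ?_
        by_contra! hpos
        simp only [hX, Finset.mem_compl, Finset.mem_filter, Finset.mem_univ, true_and] at hu hw
        exact hw (hu.tail hpos)
      push_cast at h1
      omega
    obtain ⟨p, hp, hd⟩ := exists_isPath_of_reflTransGen hRadj ht
    have hφ' := hφ.sub_walk hp hd
    rw [Nat.cast_add, Nat.cast_one, add_sub_cancel_right] at hφ'
    obtain ⟨F, hFn, hF, hFd⟩ := IsUnitFlow.exists_family hst n _ hφ'
    have hp0 : ∀ x y, p.toSubgraph.Adj x y → φ x y ≠ 0 ∧ φ x y - p.flow x y = 0 := by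
      intro x y hxy
      rw [← Subgraph.mem_edgeSet, Walk.mem_edges_toSubgraph] at hxy
      rcases p.flow_cases hp.isTrail x y with h1 | ⟨⟨d, hdp, rfl, rfl⟩, h1⟩ |
        ⟨⟨d, hdp, rfl, rfl⟩, h1⟩
      · exact absurd hxy h1.1
      · have h2 : 0 < φ d.fst d.snd := hd d hdp
        have := hφ.le_one d.fst d.snd
        omega
      · have h2 : 0 < φ d.fst d.snd := hd d hdp
        have := hφ.le_one d.fst d.snd
        have := hφ.antisymm d.fst d.snd
        omega
    have hpF : ∀ P ∈ F, p.toSubgraph.edgeSet ∩ P.edgeSet = ∅ := by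
      intro P hP
      rw [Set.eq_empty_iff_forall_notMem]
      rintro ⟨x, y⟩ ⟨h1, h2⟩
      exact (hF P hP).2 x y h2 (hp0 x y h1).2
    refine ⟨insert p.toSubgraph F, ?_, ?_, ?_⟩
    · rw [Finset.card_insert_of_notMem, hFn]
      intro hmem
      have hP : G.IsPathConnecting ∅ p.toSubgraph := ⟨⟨s, t, p, hp, rfl⟩, by simp⟩
      obtain ⟨c, hc⟩ := exists_adj_of_isPathConnecting hP p.start_mem_verts_toSubgraph
        p.end_mem_verts_toSubgraph hst
      exact (Set.eq_empty_iff_forall_notMem.1 (hpF _ hmem)) s(s, c) ⟨hc, hc⟩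
    · intro P hP
      rcases Finset.mem_insert.1 hP with rfl | hP
      · exact ⟨⟨p, hp, rfl⟩, fun x y hxy => (hp0 x y hxy).1⟩
      · refine ⟨(hF P hP).1, fun x y hxy h0 => (hF P hP).2 x y hxy ?_⟩
        rcases p.flow_cases hp.isTrail x y with h1 | ⟨⟨d, hdp, rfl, rfl⟩, h1⟩ |
          ⟨⟨d, hdp, rfl, rfl⟩, h1⟩
        · rw [h1.2, h0]; rfl
        · have h2 : 0 < φ d.fst d.snd := hd d hdp
          omega
        · have h2 : 0 < φ d.fst d.snd := hd d hdp
          have := hφ.antisymm d.fst d.snd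
          omega
    · intro P hP Q hQ hne
      rcases Finset.mem_insert.1 hP with rfl | hP <;> rcases Finset.mem_insert.1 hQ with rfl | hQ
      · exact absurd rfl hne
      · exact hpF Q hQ
      · rw [Set.inter_comm]; exact hpF P hP
      · exact hFd P hP Q hQ hne

/-- Menger's theorem for edge-disjoint paths. -/
theorem le_localPathEdgeConn_pair [DecidableRel G.Adj] (hst : s ≠ t) {n : ℕ}
    (hcut : ∀ X : Finset V, s ∈ X → t ∉ X → n ≤ ((X ×ˢ Xᶜ).filter fun e => G.Adj e.1 e.2).card) :
    n ≤ G.localPathEdgeConn {s, t} := by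
  obtain ⟨φ, hφ⟩ := exists_isUnitFlow (G := G) (s := s) (t := t) (n := n)
    (fun X hs ht => by convert hcut X hs ht) n le_rfl
  obtain ⟨F, hFn, hF, hFd⟩ := IsUnitFlow.exists_family hst n φ hφ
  rw [← hFn]
  refine G.le_localPathEdgeConn ⟨?_, hFd⟩
  intro P hP
  obtain ⟨p, hp, rfl⟩ := (hF P hP).1
  refine ⟨⟨s, t, p, hp, rfl⟩, ?_⟩
  rintro x (rfl | rfl)
  · exact p.start_mem_verts_toSubgraph
  · exact p.end_mem_verts_toSubgraph

end Flow

/-! ### Edge cuts of the line graph: claim 3 for `k = 2` -/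

theorem exists_crossing_edge {P : G.Subgraph} (hP : P.Connected) {U : Set V} {u w : V}
    (hu : u ∈ P.verts) (hw : w ∈ P.verts) (huU : u ∈ U) (hwU : w ∉ U) :
    ∃ x y, P.Adj x y ∧ x ∈ U ∧ y ∉ U := by
  obtain ⟨q⟩ := hP.preconnected ⟨u, hu⟩ ⟨w, hw⟩
  obtain ⟨d, -, h1, h2⟩ := q.exists_boundary_dart {x | x.1 ∈ U} huU hwU
  exact ⟨_, _, d.adj, h1, h2⟩

/-- The path `2`-edge-connectivity is at most the size of any edge cut. -/
theorem pathEdgeConn_two_le_card [Finite V] {U : Set V} {u w : V} (hu : u ∈ U) (hw : w ∉ U)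
    {K : Finset G.edgeSet}
    (hK : ∀ x y (h : G.Adj x y), x ∈ U → y ∉ U → (⟨s(x, y), h⟩ : G.edgeSet) ∈ K) :
    G.pathEdgeConn 2 ≤ K.card := by
  classical
  have hne : u ≠ w := fun h => hw (h ▸ hu)
  have h1 := pathEdgeConn_le_localPathEdgeConn (G := G) {u, w}
  rw [Finset.card_pair hne] at h1
  refine h1.trans ?_
  obtain ⟨F, ⟨hF, hFd⟩, hFc⟩ :=
    G.exists_family_localPathEdgeConn ((({u, w} : Finset V) : Set V))
  rw [← hFc]
  have hex : ∀ P ∈ F, ∃ e : Sym2 V, e ∈ P.edgeSet ∧ e ∈ K.image Subtype.val := by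
    intro P hP
    obtain ⟨⟨a, b, p, -, rfl⟩, hS⟩ := hF P hP
    obtain ⟨x, y, hxy, hx, hy⟩ := exists_crossing_edge p.toSubgraph_connected
      (hS (by simp)) (hS (by simp)) hu hw
    exact ⟨s(x, y), hxy, Finset.mem_image.2 ⟨_, hK x y (Subgraph.adj_sub _ hxy) hx hy, rfl⟩⟩
  have hnonempty : Nonempty (Sym2 V) := ⟨s(u, w)⟩
  choose! f hf using hex
  rw [← Finset.card_image_of_injective K Subtype.val_injective]
  refine Finset.card_le_card_of_injOn f (fun P hP => (hf P hP).2) ?_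
  intro P hP Q hQ hPQ
  by_contra hne
  refine (Set.eq_empty_iff_forall_notMem.1 (hFd P hP Q hQ hne)) (f P) ⟨(hf P hP).1, ?_⟩
  rw [hPQ]
  exact (hf Q hQ).1

/-- Away from `v` the set `Z` contains all or none of the edges at a vertex. Hence every edge
leaving the set of vertices other than `v` touched by `Z` lies in `Z` and ends at `v`. -/
theorem pathEdgeConn_two_le_card_filter [Finite V] [DecidableEq V] {Z : Finset G.edgeSet}
    {c : G.edgeSet} (hc : c ∈ Z) {v : V}
    (hZ : ∀ u ≠ v, ∀ e ∈ Z, u ∈ e.1 → ∀ f, u ∈ f.1 → f ∈ Z) :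
    G.pathEdgeConn 2 ≤ (Z.filter fun e => v ∈ e.1).card := by
  obtain ⟨u, huv, huc⟩ : ∃ u, u ≠ v ∧ u ∈ c.1 := by
    obtain ⟨⟨a, b⟩, hab⟩ := c
    have hne : a ≠ b := G.ne_of_adj hab
    by_cases h : a = v
    · exact ⟨b, fun hb => hne (h.trans hb.symm), Sym2.mem_mk_right a b⟩
    · exact ⟨a, h, Sym2.mem_mk_left a b⟩
  refine pathEdgeConn_two_le_card (U := {u | u ≠ v ∧ ∃ e ∈ Z, u ∈ e.1}) (u := u) (w := v)
    ⟨huv, c, hc, huc⟩ (fun h => h.1 rfl) ?_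
  rintro x y hxy ⟨hxv, e, he, hxe⟩ hy
  have hmem : (⟨s(x, y), hxy⟩ : G.edgeSet) ∈ Z := hZ x hxv e he hxe _ (by simp)
  refine Finset.mem_filter.2 ⟨hmem, ?_⟩
  by_cases hyv : y = v
  · simp [hyv]
  · exact absurd ⟨hyv, _, hmem, by simp⟩ hy

/-- A vertex with `x` edges inside `X` and `y` outside contributes `x * y` cut edges. If two
vertices are mixed, each contributes at least `x + y - 1`, and `x + y` is at least `ω₂(G)` because
the star of a vertex is a cut. If at most one vertex `v` is mixed, the edges at `v` on either side
already form a cut of `G`, so both factors at `v` are at least `ω₂(G)`. -/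
theorem two_mul_pathEdgeConn_two_le_card_cut [Fintype V] [DecidableEq V] [Fintype G.edgeSet]
    [DecidableRel G.lineGraph.Adj] {X : Finset G.edgeSet} {a b : G.edgeSet} (ha : a ∈ X)
    (hb : b ∉ X) :
    2 * G.pathEdgeConn 2 ≤
      ((X ×ˢ Xᶜ).filter fun e => G.lineGraph.Adj e.1 e.2).card + 2 := by
  set K := (X ×ˢ Xᶜ).filter fun e => G.lineGraph.Adj e.1 e.2 with hK
  set x : V → Finset G.edgeSet := fun v => X.filter fun e => v ∈ e.1 with hx
  set y : V → Finset G.edgeSet := fun v => Xᶜ.filter fun e => v ∈ e.1 with hy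
  have hsub : ∀ v, x v ×ˢ y v ⊆ K := by
    rintro v ⟨e, f⟩ hef
    simp only [hx, hy, Finset.mem_product, Finset.mem_filter] at hef
    refine Finset.mem_filter.2 ⟨Finset.mem_product.2 ⟨hef.1.1, hef.2.1⟩, ?_, v, hef.1.2, hef.2.2⟩
    rintro (rfl : e = f)
    exact (Finset.mem_compl.1 hef.2.1) hef.1.1
  have hdeg : ∀ v, G.pathEdgeConn 2 ≤ (x v).card + (y v).card := by
    intro v
    obtain ⟨w, hw⟩ : ∃ w, w ≠ v := by
      obtain ⟨⟨c, d⟩, hcd⟩ := a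
      by_cases h : c = v
      · exact ⟨d, fun hd => G.ne_of_adj hcd (h.trans hd.symm)⟩
      · exact ⟨c, h⟩
    rw [← Finset.card_union_of_disjoint]
    · refine pathEdgeConn_two_le_card (U := {v}) (u := v) (w := w) rfl hw ?_
      rintro c d hcd rfl -
      by_cases h : (⟨s(c, d), hcd⟩ : G.edgeSet) ∈ X <;> simp [hx, hy, h]
    · rw [Finset.disjoint_left]
      intro e he he'
      exact (Finset.mem_compl.1 (Finset.mem_filter.1 he').1) (Finset.mem_filter.1 he).1
  by_cases hmix : ∃ v w, v ≠ w ∧ ((x v).Nonempty ∧ (y v).Nonempty) ∧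
      ((x w).Nonempty ∧ (y w).Nonempty)
  · obtain ⟨v, w, hvw, ⟨h1, h2⟩, h3, h4⟩ := hmix
    have hdisj : Disjoint (x v ×ˢ y v) (x w ×ˢ y w) := by
      rw [Finset.disjoint_left]
      rintro ⟨e, f⟩ h5 h6
      have hadj := (Finset.mem_filter.1 (hsub v h5)).2
      simp only [hx, hy, Finset.mem_product, Finset.mem_filter] at h5 h6
      exact hvw (eq_of_mem_of_ne hadj.1 h5.1.2 h5.2.2 h6.1.2 h6.2.2)
    have h5 := Finset.card_le_card (Finset.union_subset (hsub v) (hsub w))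
    rw [Finset.card_union_of_disjoint hdisj, Finset.card_product, Finset.card_product] at h5
    have key : ∀ m n : ℕ, 0 < m → 0 < n → m + n ≤ m * n + 1 := by
      intro m n hm hn
      nlinarith
    have h6 := key _ _ h1.card_pos h2.card_pos
    have h7 := key _ _ h3.card_pos h4.card_pos
    have := hdeg v
    have := hdeg w
    omega
  · obtain ⟨v, hv⟩ : ∃ v, ∀ u ≠ v, ¬ ((x u).Nonempty ∧ (y u).Nonempty) := by
      by_cases h : ∃ v, (x v).Nonempty ∧ (y v).Nonempty
      · obtain ⟨v, hv⟩ := h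
        exact ⟨v, fun u hu hu' => hmix ⟨u, v, hu, hu', hv⟩⟩
      · push Not at h
        -- Without mixed vertices any `v` will do.
        exact ⟨a.1.out.1, fun u _ hu => hu.2.ne_empty (h u hu.1)⟩
    have h1 : G.pathEdgeConn 2 ≤ (x v).card := by
      refine pathEdgeConn_two_le_card_filter ha fun u hu e he hue f huf => ?_
      by_contra hf
      exact hv u hu ⟨⟨e, by simp [hx, he, hue]⟩, ⟨f, by simp [hy, hf, huf]⟩⟩
    have h2 : G.pathEdgeConn 2 ≤ (y v).card := by
      refine pathEdgeConn_two_le_card_filter (Finset.mem_compl.2 hb)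
        fun u hu e he hue f huf => ?_
      by_contra hf
      rw [Finset.mem_compl, not_not] at hf
      exact hv u hu ⟨⟨f, by simp [hx, hf, huf]⟩, ⟨e, by simpa [hy, hue] using he⟩⟩
    have h3 := Finset.card_le_card (hsub v)
    rw [Finset.card_product] at h3
    have h4 := Nat.mul_le_mul h1 h2
    -- With `c` for `ω₂(G)`: `2 * c ≤ c ^ 2 + 2`, as `(c - 1) ^ 2 ≥ 0`.
    nlinarith [Nat.mul_le_mul h1 h2, sq_nonneg ((G.pathEdgeConn 2 : ℤ) - 1)]

theorem two_mul_pathConn_two_le [Finite V] (hV : 2 ≤ Nat.card V)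
    (hE : 2 ≤ Nat.card G.lineGraph.edgeSet) :
    2 * G.pathConn 2 ≤ G.lineGraph.lineGraph.pathConn 2 + 2 := by
  classical
  have := Fintype.ofFinite V
  obtain ⟨S, hSk, hS⟩ := exists_pathConn_eq (G := G.lineGraph.lineGraph) hE
  obtain ⟨r, hr, hcard⟩ := exists_representatives S
  have hle : (S.image r).card ≤ S.card := Finset.card_image_le
  have h2 : (S.image r).card = 2 := by omega
  have h3 := (localPathEdgeConn_le_of_lineGraph (S := S) (r := r) (fun e _ => hr e) (by omega)
    (C := 0) (by omega) le_rfl).2 (Or.inr rfl)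
  rw [hS] at h3
  obtain ⟨a, b, hab, hSab⟩ := Finset.card_eq_two.1 h2
  rw [hSab, Finset.coe_pair] at h3
  have h4 := le_localPathEdgeConn_pair (G := G.lineGraph) hab (n := 2 * G.pathEdgeConn 2 - 2)
    fun X ha hb => by
      have := two_mul_pathEdgeConn_two_le_card_cut ha hb
      omega
  have h5 := pathConn_le_pathEdgeConn (G := G) hV
  omega

end SimpleGraph

/-! ### The proposition -/

theorem proposition2p3 {V : Type*} [Fintype V] (G : SimpleGraph V) (k : ℕ)
    (hk : 2 ≤ k) (hkn : k ≤ Fintype.card V) (hG : G.IsEdgeConnected 2) :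
    (2 : ℝ) ^ (2 - (k : ℤ)) * (G.pathEdgeConn k : ℝ) ≤ (G.lineGraph.pathConn k : ℝ) ∧
    (G.lineGraph.pathEdgeConn k : ℝ) ≥ (2 : ℝ) ^ (2 - (k : ℤ)) * (G.pathEdgeConn k : ℝ) ∧
    (G.lineGraph.lineGraph.pathConn k : ℝ) ≥
      (2 : ℝ) ^ (3 - (k : ℤ)) * ((G.pathConn k : ℝ) - 1) := by
  classical
  have hV : k ≤ Nat.card V := by rwa [Nat.card_eq_fintype_card]
  have hnt : Nontrivial V := Fintype.one_lt_card_iff_nontrivial.1 (by omega)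
  -- Edge-connectivity enters only through minimum degree two, which ensures that both iterated line
  -- graphs have `k`-sets of vertices, so that the minima are attained.
  have hdeg : ∀ v, ∃ a b, a ≠ b ∧ G.Adj v a ∧ G.Adj v b := by
    intro v
    have h2 : 2 ≤ G.degree v := hG.le_degree
    rw [← SimpleGraph.card_neighborFinset_eq_degree] at h2
    obtain ⟨a, ha, b, hb, hab⟩ := Finset.one_lt_card.1 h2
    exact ⟨a, b, hab, by simpa using ha, by simpa using hb⟩
  have hE : k ≤ Nat.card G.edgeSet := hV.trans (SimpleGraph.card_le_card_edgeSet hdeg)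
  have hE' : k ≤ Nat.card G.lineGraph.edgeSet :=
    hE.trans (SimpleGraph.card_le_card_edgeSet (SimpleGraph.lineGraph_exists_two_adj hdeg))
  have h1 : (2 : ℝ) ^ (2 - (k : ℤ)) * (G.pathEdgeConn k : ℝ) ≤ (G.lineGraph.pathConn k : ℝ) := by
    have h : (G.pathEdgeConn k : ℝ) ≤ 2 ^ (k - 2) * (G.lineGraph.pathConn k : ℝ) := by
      exact_mod_cast SimpleGraph.pathEdgeConn_le_two_pow_mul hk hV hE
    have hz : (2 : ℝ) ^ (2 - (k : ℤ)) = (2 ^ (k - 2))⁻¹ := by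
      rw [← zpow_natCast, ← zpow_neg, Nat.cast_sub hk]
      congr 1
      push_cast
      ring
    rw [hz, inv_mul_le_iff₀ (by positivity)]
    exact h
  refine ⟨h1, h1.trans ?_, ?_⟩
  · exact_mod_cast SimpleGraph.pathConn_le_pathEdgeConn hE
  · rcases hk.eq_or_lt with rfl | hk3
    · have h : (2 : ℝ) * G.pathConn 2 ≤ G.lineGraph.lineGraph.pathConn 2 + 2 := by
        exact_mod_cast SimpleGraph.two_mul_pathConn_two_le hV hE'
      norm_num
      linarith
    · have h : (G.pathConn k : ℝ) ≤ 2 ^ (k - 3) * (G.lineGraph.lineGraph.pathConn k : ℝ) + 1 := by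
        exact_mod_cast SimpleGraph.pathConn_le_of_lineGraph_lineGraph hk3 hV hE'
      have hz : (2 : ℝ) ^ (3 - (k : ℤ)) = (2 ^ (k - 3))⁻¹ := by
        rw [← zpow_natCast, ← zpow_neg, Nat.cast_sub (show 3 ≤ k from hk3)]
        congr 1
        push_cast
        ring
      rw [ge_iff_le, hz, inv_mul_le_iff₀ (by positivity)]
      linarith
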